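/- Let $d\ge 1$. Let $\Gamma$ be the set of configurations $\eta\subset\mathbb R^d$ with $N(\eta\cap\Delta):=\#(\eta\cap\Delta)<\infty$ for every bounded $\Delta$, with the $\sigma$-algebra generated by the events $\{N(\cdot\cap\Delta)=m\}$, $\Delta$ bounded Borel, $m\in\mathbb N_0$; put $\Gamma_{\Lambda^c}=\{\eta\in\Gamma:\eta\cap\Lambda=\emptyset\}$, and write $\{\boldsymbol x_n\}=\{x_1,\dots,x_n\}$. Fix an increasing sequence $(\Lambda_m)$ of bounded Borel sets such that every bounded set is contained in some $\Lambda_m$. *Hamiltonian and interaction.* Let $H:\Gamma\to\mathbb R\cup\{\infty\}$ be measurable, translation-invariant, hereditary ($H(\eta)=\infty$ implies $H(\eta\cup\{x\})=\infty$), stable (there is $B>0$ with $H(\{\boldsymbol x_n\})\ge -Bn$ for all finite configurations of $n$ points), and without self-interaction ($H(\{x\})=0$). For finite $\xi$ and $\eta\in\Gamma$ let $W(\xi\mid\eta)=\lim_{m\to\infty}\big(H(\xi\cup\eta_m)-H(\xi)-H(\eta_m)\big)$ with $\eta_m=\eta\cap\Lambda_m$, where the term is $+\infty$ if $H(\xi\cup\eta_m)=\infty$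 (when the limit does not exist, use the lower limit). Call $\eta$ tempered if for all finite $\xi$ disjoint from $\eta$ this limit exists in $\mathbb R\cup\{+\infty\}$, and $W(\xi\mid\eta)=\infty$ implies $W(\xi\cup\{x\}\mid\eta)=\infty$ for all $x\notin\eta$. *Gibbs measure.* Let $\mu\in\mathbb R$ and let $P$ be a translation-invariant $(\mu,H)$-Gibbs measure, i.e. a translation-invariant probability measure on $\Gamma$ such that $P$-almost every $\eta$ is tempered and, for all measurable $G:\Gamma\to[0,\infty]$ and all bounded Borel $\Lambda\subset\mathbb R^d$, $$\int_\Gamma G\,dP=\int_{\Gamma_{\Lambda^c}}\sum_{n\ge0}\frac{e^{n\mu}}{n!}\int_{\Lambda^n}G(\{\boldsymbol x_n\}\cup\eta)\,e^{-H(\{\boldsymbol x_n\})-W(\{\boldsymbol x_n\}\mid\eta)}\,d\boldsymbol x_n\,dP(\eta).$$ *Correlation functions.* Let $j^{(n)}_\Lambda(\boldsymbol x_n)=\int_{\Gamma_{\Lambda^c}}e^{n\mu-H(\{\boldsymbol x_n\})-W(\{\boldsymbol x_n\}\mid\eta)}\,dP(\eta)$ be the Janossy densities and $\rho^{(n)}(\boldsymbol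 x_n)=\sum_{k\ge0}\frac1{k!}\int_{\Lambda^k}j_\Lambda^{(n+k)}(\boldsymbol x_n,\boldsymbol y_k)\,d\boldsymbol y_k$ the correlation functions; here $\Lambda$ is a bounded Borel set containing $x_1,\dots,x_n$ and the choice is immaterial (to fix it, take the closed ball about $0$ of radius $1+\sum_i|x_i|$). Put $\rho=\rho^{(1)}(0)$, the density. With $\Pi_l$ denoting the set of partitions into $l$ nonempty blocks $\pi_1,\dots,\pi_l$ and $\kappa_i=\#\pi_i$, define recursively $\rho_T^{(1)}=\rho^{(1)}$ and, for $n\ge2$, $$\rho_T^{(n)}(\boldsymbol x_n)=\rho^{(n)}(\boldsymbol x_n)-\sum_{l=2}^n\sum_{\pi\in\Pi_l(\{\boldsymbol x_n\})}\prod_{i=1}^l\rho_T^{(\kappa_i)}(\pi_i),$$ and $\widetilde\rho_T^{(2)}(x,y)=\rho_T^{(2)}(x,y)/\rho$ and, for $k\ge2$, $$\widetilde\rho_T^{(1+k)}(x,\boldsymbol y_k)=\frac{\rho_T^{(1+k)}(x,\boldsymbol y_k)}{\rho}-\sum_{l=2}^k\sum_{\pi\in\Pi_l(\{\boldsymbol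 y_k\})}\prod_{i=1}^l\widetilde\rho_T^{(1+\kappa_i)}(x,\pi_i).$$ *Assumptions.* Suppose that - (Ruelle condition) there is $\xi>0$ with $0\le\rho^{(n)}(\boldsymbol x_n)\le\xi^n$ for all $n\ge1$ and $\boldsymbol x_n\in(\mathbb R^d)^n$; - (A) for every bounded $\Delta\subset\mathbb R^d$, $\displaystyle\lim_{m\to\infty}\sup_{x\in\Delta}\Big|\log\int_{\Gamma_{\Lambda_m^c}}e^{-W(\{x\}\mid\eta)}\,dP(\eta)-\log P(\Gamma_{\Lambda_m^c})\Big|=0$; - (B) there are $D,q>0$ with $\displaystyle\sup_{x\in\mathbb R^d}\int_{\Lambda^n}\frac1\rho\big|\rho_T^{(1+n)}(x,\boldsymbol y_n)\big|\,d\boldsymbol y_n\le n!\,D\,q^n$ for all bounded Borel $\Lambda$ and all $n\ge1$. **Theorem.** If $q<q_0:=\dfrac1{2(2+\zeta D)}$ with $\zeta=\dfrac1{2\log2-1}$, then $\rho>0$, the functions $\widetilde\rho_T^{(1+k)}(0,\cdot)$, $k\ge1$, are integrable on $(\mathbb R^d)^k$, the following series converges absolutely, and $$\mu=\log\rho+\sum_{k=1}^\infty\frac{(-1)^k}{k!}\int_{(\mathbb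 R^d)^k}\widetilde\rho_T^{(1+k)}(0,\boldsymbol y_k)\,d\boldsymbol y_k.$$ -/

import Mathlib

open MeasureTheory Filter Topology
open scoped ENNReal

noncomputable section

namespace Gibbs

/-- The one-particle space `ℝ^d`. -/
abbrev Pt (d : ℕ) : Type := EuclideanSpace ℝ (Fin d)

/-- The space `Γ` of locally finite configurations in `ℝ^d`. -/
structure Config (d : ℕ) : Type where
  carrier : Set (Pt d)
  locallyFinite : ∀ Δ : Set (Pt d), Bornology.IsBounded Δ → (carrier ∩ Δ).Finite

namespace Config

variable {d : ℕ}

/-- The number of particles of `η` in `Δ` (meaningful for bounded `Δ`). -/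
def count (Δ : Set (Pt d)) (η : Config d) : ℕ := (η.1 ∩ Δ).ncard

/-- The σ-algebra generated by the events `{N(· ∩ Δ) = m}`, `Δ` bounded Borel. -/
instance : MeasurableSpace (Config d) :=
  MeasurableSpace.generateFrom
    {A | ∃ (Δ : Set (Pt d)) (m : ℕ), Bornology.IsBounded Δ ∧ MeasurableSet Δ ∧
      A = {η : Config d | count Δ η = m}}

/-- Union of two configurations. -/
def union (ξ η : Config d) : Config d :=
  ⟨ξ.1 ∪ η.1, fun Δ hΔ => by
    rw [Set.union_inter_distrib_right]
    exact (ξ.2 Δ hΔ).union (η.2 Δ hΔ)⟩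

/-- The part `η ∩ Δ` of the configuration `η` inside `Δ`. -/
def restrict (η : Config d) (Δ : Set (Pt d)) : Config d :=
  ⟨η.1 ∩ Δ, fun Δ' hΔ' =>
    (η.2 Δ' hΔ').subset (Set.inter_subset_inter_left _ Set.inter_subset_left)⟩

/-- The finite configuration `{x_1, …, x_n}`. -/
def ofTuple {n : ℕ} (x : Fin n → Pt d) : Config d :=
  ⟨Set.range x, fun _ _ => (Set.finite_range x).subset Set.inter_subset_left⟩

/-- The one-point configuration `{x}`. -/
def single (x : Pt d) : Config d :=
  ⟨{x}, fun _ _ => (Set.finite_singleton x).subset Set.inter_subset_left⟩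

/-- The translate `τ_x(η) = {y - x | y ∈ η}`. -/
def shift (x : Pt d) (η : Config d) : Config d :=
  ⟨(fun y => y - x) '' η.1, fun Δ hΔ => by
    have h : Bornology.IsBounded ((fun y => y + x) '' Δ) := by
      simpa [Set.image_add_right, Set.add_singleton] using
        (Bornology.IsBounded.add hΔ (Bornology.isBounded_singleton (x := x)))
    refine ((η.2 _ h).image (fun y => y - x)).subset ?_
    rintro _ ⟨⟨y, hy, rfl⟩, hz⟩
    exact ⟨y, ⟨hy, ⟨y - x, hz, by simp⟩⟩, rfl⟩⟩

/-- `Γ_{Λᶜ}`: the configurations without a particle in `Λ`. -/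
def outside (Λ : Set (Pt d)) : Set (Config d) := {η | η.1 ⊆ Λᶜ}

end Config

variable {d : ℕ}

/-- The box `Λ^n` of `n`-tuples of points of `Λ`. -/
def box (Λ : Set (Pt d)) (n : ℕ) : Set (Fin n → Pt d) := {x | ∀ i, x i ∈ Λ}

/-- The standing assumptions on a Hamiltonian `H : Γ → ℝ ∪ {∞}`. -/
structure IsHamiltonian (H : Config d → EReal) : Prop where
  measurable : Measurable H
  ne_bot : ∀ η, H η ≠ ⊥
  translation_invariant : ∀ (x : Pt d) (η : Config d), H (η.shift x) = H η
  hereditary : ∀ (η : Config d) (x : Pt d), H η = ⊤ → H (η.union (Config.single x)) = ⊤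
  no_self_interaction : ∀ x : Pt d, H (Config.single x) = 0
  stable : ∃ B : ℝ, 0 < B ∧
    ∀ η : Config d, η.1.Finite → ((-(B * (η.1.ncard : ℝ)) : ℝ) : EReal) ≤ H η

/-- `Λ_m ↗ ℝ^d`: an increasing sequence of bounded Borel sets which eventually contains every
bounded set. -/
structure IsExhausting (Λ : ℕ → Set (Pt d)) : Prop where
  mono : Monotone Λ
  bounded : ∀ m, Bornology.IsBounded (Λ m)
  measurable : ∀ m, MeasurableSet (Λ m)
  exhausts : ∀ Δ : Set (Pt d), Bornology.IsBounded Δ → ∃ m, Δ ⊆ Λ m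

/-- `H(ξ ∪ η) - H(ξ) - H(η)`, with the value `+∞` if `H(ξ ∪ η) = +∞`. -/
def mutualEnergy (H : Config d → EReal) (ξ η : Config d) : EReal :=
  open Classical in
  if H (ξ.union η) = ⊤ then ⊤ else H (ξ.union η) - H ξ - H η

/-- The interaction `W(ξ ∣ η)` of a finite configuration `ξ` with a possibly infinite
configuration `η`: the limit of the interaction of `ξ` with `η ∩ Λ_m`. It is written as a lower
limit so that it is defined everywhere; on tempered configurations (below) it is a limit. -/
def interaction (Λ : ℕ → Set (Pt d)) (H : Config d → EReal) (ξ η : Config d) : EReal :=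
  liminf (fun m => mutualEnergy H ξ (η.restrict (Λ m))) atTop

/-- `η` is tempered if the interaction of `η` with every finite configuration `ξ` outside `η`
exists as a limit in `ℝ ∪ {+∞}`, and if a forbidden configuration `ξ ∪ η` (one with
`W(ξ ∣ η) = +∞`) stays forbidden when another particle is added. -/
structure IsTempered (Λ : ℕ → Set (Pt d)) (H : Config d → EReal) (η : Config d) : Prop where
  exists_limit : ∀ ξ : Config d, ξ.1.Finite → Disjoint ξ.1 η.1 →
    ∃ w : EReal, w ≠ ⊥ ∧
      Tendsto (fun m => mutualEnergy H ξ (η.restrict (Λ m))) atTop (𝓝 w)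
  hereditary : ∀ ξ : Config d, ξ.1.Finite → Disjoint ξ.1 η.1 → ∀ x : Pt d, x ∉ η.1 →
    interaction Λ H ξ η = ⊤ → interaction Λ H (ξ.union (Config.single x)) η = ⊤

/-- The Boltzmann factor `exp(-H(ξ) - W(ξ ∣ η))`. -/
def boltzmann (Λ : ℕ → Set (Pt d)) (H : Config d → EReal) (ξ η : Config d) : ℝ≥0∞ :=
  EReal.exp (-(H ξ + interaction Λ H ξ η))

/-- `P` is a `(μ, H)`-Gibbs measure: it is carried by the tempered configurations and satisfies
the Ruelle equation for every bounded Borel set `Δ`. -/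
structure IsGibbs (Λ : ℕ → Set (Pt d)) (μ : ℝ) (H : Config d → EReal)
    (P : Measure (Config d)) : Prop where
  tempered : ∀ᵐ η ∂P, IsTempered Λ H η
  ruelle_equation : ∀ Δ : Set (Pt d), Bornology.IsBounded Δ → MeasurableSet Δ →
    ∀ G : Config d → ℝ≥0∞, Measurable G →
      ∫⁻ η, G η ∂P =
        ∫⁻ η in Config.outside Δ,
          (∑' n : ℕ, ENNReal.ofReal (Real.exp (n * μ) / n.factorial) *
            ∫⁻ x in box Δ n,
              G ((Config.ofTuple x).union η) * boltzmann Λ H (Config.ofTuple x) η) ∂P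

/-- `P` is translation-invariant. -/
def IsTranslationInvariant (P : Measure (Config d)) : Prop :=
  ∀ x : Pt d, MeasurePreserving (Config.shift x) P P

/-- The Janossy density
`j_Δ^{(n)}(x) = ∫_{Γ_{Δᶜ}} exp(nμ - H({x}) - W({x} ∣ η)) dP(η)`, for `x ∈ Δ^n`. -/
def janossy (Λ : ℕ → Set (Pt d)) (μ : ℝ) (H : Config d → EReal) (P : Measure (Config d))
    (Δ : Set (Pt d)) (n : ℕ) (x : Fin n → Pt d) : ℝ≥0∞ :=
  ∫⁻ η in Config.outside Δ,
    ENNReal.ofReal (Real.exp (n * μ)) * boltzmann Λ H (Config.ofTuple x) η ∂P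

/-- `∑_k (1/k!) ∫_{Δ^k} j_Δ^{(n+k)}(x, y) dy`. -/
def corrIn (Λ : ℕ → Set (Pt d)) (μ : ℝ) (H : Config d → EReal) (P : Measure (Config d))
    (Δ : Set (Pt d)) (n : ℕ) (x : Fin n → Pt d) : ℝ≥0∞ :=
  ∑' k : ℕ, ((k.factorial : ℕ) : ℝ≥0∞)⁻¹ *
    ∫⁻ y in box Δ k, janossy Λ μ H P Δ (n + k) (Fin.append x y)

/-- The correlation function `ρ^{(n)}(x) = ∑_k (1/k!) ∫_{Δ^k} j_Δ^{(n+k)}(x, y) dy`. For a Gibbs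
measure the right-hand side is the same for all bounded `Δ` with `x ∈ Δ^n`; a ball that contains
the points `x_i` is used here. -/
def corr (Λ : ℕ → Set (Pt d)) (μ : ℝ) (H : Config d → EReal) (P : Measure (Config d))
    (n : ℕ) (x : Fin n → Pt d) : ℝ≥0∞ :=
  corrIn Λ μ H P (Metric.closedBall 0 (1 + ∑ i, ‖x i‖)) n x

/-- The (constant) density `ρ = ρ^{(1)}`. -/
def density (Λ : ℕ → Set (Pt d)) (μ : ℝ) (H : Config d → EReal) (P : Measure (Config d)) : ℝ :=
  (corr Λ μ H P 1 (fun _ => 0)).toReal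

theorem card_lt_of_mem_parts {n : ℕ} (π : Finpartition (Finset.univ : Finset (Fin n)))
    (h : 2 ≤ π.parts.card) {b : Finset (Fin n)} (hb : b ∈ π.parts) : b.card < n := by
  obtain ⟨c, hc, hcb⟩ := Finset.exists_mem_ne (by omega : 1 < π.parts.card) b
  obtain ⟨i, hi⟩ := π.nonempty_of_mem_parts hc
  have hdis : Disjoint c b := π.disjoint hc hb hcb
  have hib : i ∉ b := fun hib => Finset.disjoint_left.mp hdis hi hib
  have := Finset.card_lt_univ_of_notMem hib
  simpa using this

/-- The truncation of a family of symmetric functions `(F_n)`, defined recursively by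
`F_{T,n}(x) = F_n(x) - ∑_{l=2}^n ∑_{π ∈ Π_l} ∏_{b ∈ π} F_{T,|b|}(x_b)`, where `Π_l` is the set of
partitions of the index set into `l` nonempty blocks and `x_b = (x_i)_{i ∈ b}`. -/
def truncate {X : Type} (F : ∀ n : ℕ, (Fin n → X) → ℝ) (n : ℕ) (x : Fin n → X) : ℝ :=
  F n x - ∑ π : {π : Finpartition (Finset.univ : Finset (Fin n)) // 2 ≤ π.parts.card},
    ∏ b : {b : Finset (Fin n) // b ∈ π.1.parts},
      truncate F b.1.card (fun i => x (b.1.orderEmbOfFin rfl i))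
termination_by n
decreasing_by exact card_lt_of_mem_parts π.1 π.2 b.2

/-- The truncated correlation functions `ρ_T^{(n)}`. -/
def truncCorr (Λ : ℕ → Set (Pt d)) (μ : ℝ) (H : Config d → EReal) (P : Measure (Config d))
    (n : ℕ) (x : Fin n → Pt d) : ℝ :=
  truncate (fun n x => (corr Λ μ H P n x).toReal) n x

/-- The functions `ρ̃_T^{(1+k)}(x, y)`, defined recursively by
`ρ̃_T^{(1+k)}(x, y) = ρ_T^{(1+k)}(x, y) / ρ - ∑_{l=2}^k ∑_{π ∈ Π_l} ∏_{b ∈ π} ρ̃_T^{(1+|b|)}(x, y_b)`;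
the partitions are those of the index set of `y = (y_1, …, y_k)`. -/
def tildeCorr (Λ : ℕ → Set (Pt d)) (μ : ℝ) (H : Config d → EReal) (P : Measure (Config d))
    (x : Pt d) (k : ℕ) (y : Fin k → Pt d) : ℝ :=
  truncate (fun k y => truncCorr Λ μ H P (k + 1) (Fin.cons x y) / density Λ μ H P) k y

/-- Ruelle condition: `0 ≤ ρ^{(n)} ≤ ξ^n` for some `ξ > 0` and all `n ≥ 1`. -/
def RuelleCondition (Λ : ℕ → Set (Pt d)) (μ : ℝ) (H : Config d → EReal)
    (P : Measure (Config d)) : Prop :=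
  ∃ ξ : ℝ, 0 < ξ ∧ ∀ n : ℕ, 1 ≤ n → ∀ x : Fin n → Pt d,
    corr Λ μ H P n x ≤ ENNReal.ofReal (ξ ^ n)

/-- Negligible boundary interaction: for every bounded `Δ`,
`sup_{x ∈ Δ} |log ∫_{Γ_{Λᶜ}} exp(-W({x} ∣ η)) dP(η) - log ∫_{Γ_{Λᶜ}} dP(η)| → 0` as
`Λ ↗ ℝ^d`. The logarithms are extended-real valued, `log 0 = -∞` and `log ∞ = ∞`. -/
def AssumptionA (Λ : ℕ → Set (Pt d)) (H : Config d → EReal) (P : Measure (Config d)) : Prop :=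
  ∀ Δ : Set (Pt d), Bornology.IsBounded Δ →
    Tendsto (fun m => ⨆ x ∈ Δ,
      (ENNReal.log (∫⁻ η in Config.outside (Λ m),
          EReal.exp (-interaction Λ H (Config.single x) η) ∂P) -
        ENNReal.log (P (Config.outside (Λ m)))).abs) atTop (𝓝 0)

/-- Factorial bounds on the truncated correlation functions, with constants `D` and `q`. -/
def AssumptionB (Λ : ℕ → Set (Pt d)) (μ : ℝ) (H : Config d → EReal) (P : Measure (Config d))
    (D q : ℝ) : Prop :=
  ∀ Δ : Set (Pt d), Bornology.IsBounded Δ → MeasurableSet Δ → ∀ n : ℕ, 1 ≤ n → ∀ x : Pt d,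
    ∫⁻ y in box Δ n,
        ENNReal.ofReal (1 / density Λ μ H P * |truncCorr Λ μ H P (n + 1) (Fin.cons x y)|)
      ≤ ENNReal.ofReal (n.factorial * D * q ^ n)

/-- `ζ = 1 / (2 log 2 - 1)`. -/
def zeta : ℝ := 1 / (2 * Real.log 2 - 1)

end Gibbs

end

/-! The chemical potential is read off from two Janossy densities in a finite volume `Δ` containing
the origin. One is `j⁽⁰⁾ = P(Γ_{Δᶜ})`, and the other is `j⁽¹⁾(0) = e^μ ∫_{Γ_{Δᶜ}} e^{-W({0}|η)} dP`,
by absence of self-interaction. By assumption (A) the logarithm of `j⁽¹⁾(0) / j⁽⁰⁾` tends to `μ`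
along `Λ_m`. It remains to expand this ratio in correlation functions.

The Ruelle equation and additivity of the energy (`boltzmann_mul_boltzmann`) make the correlation
functions independent of the volume (`corr_eq`). The Ruelle bound then permits inversion: `j⁽ⁿ⁾(x) =
∑_k (-1)^k/k! ∫_{Δ^k} ρ⁽ⁿ⁺ᵏ⁾(x, y) dy` (`hasSum_janossy`). Splitting `ρ⁽¹⁺ⁿ⁾(0, y)` by the cluster
containing `0` (`cons_eq_sum_truncate_mul`) turns the series for `j⁽¹⁾(0)` into a Cauchy product:
`j⁽¹⁾(0) = ρ · A · j⁽⁰⁾`, where `A = ∑_k (-1)^k/k! ∫_{Δ^k} ρ_T⁽¹⁺ᵏ⁾(0, y)/ρ dy`.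

The functions `ρ̃_T` are the truncation of `ρ_T⁽¹⁺ᵏ⁾(0, ·)/ρ`. Truncation is a logarithm at the
level of generating functions, so `A = exp S`, with `S` the same alternating series built from
`ρ̃_T` (`tsum_eq_exp_tsum`). The result is the finite-volume identity `j⁽¹⁾(0) = ρ e^S j⁽⁰⁾`
(`janossy_one_eq`).

All convergence rests on one majorant (`lintegral_truncate_le_of_bound`): (B) bounds the `L¹` norm
of `ρ̃_T⁽¹⁺ᵏ⁾(0, ·)` over the whole space by `k! ((1+D)q)^k`, and the smallness of `q` gives `(1+D)q
< 1`. The bound is uniform in the volume, so dominated convergence takes `S` to its infinite-volume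
value. -/

noncomputable section

namespace Gibbs

/-! ### Measurability on configuration space -/

section

namespace Config

variable {d : ℕ}

theorem ext_carrier {ξ η : Config d} (h : ξ.1 = η.1) : ξ = η := by
  cases ξ; cases η; cases h; rfl

theorem measurable_count {Δ : Set (Pt d)} (hb : Bornology.IsBounded Δ) (hm : MeasurableSet Δ) :
    Measurable (count Δ) :=
  measurable_to_countable' fun m =>
    MeasurableSpace.measurableSet_generateFrom ⟨Δ, m, hb, hm, rfl⟩

theorem measurable_of_count {α : Type*} [MeasurableSpace α] {f : α → Config d}
    (h : ∀ Δ : Set (Pt d), Bornology.IsBounded Δ → MeasurableSet Δ →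
      Measurable fun a => count Δ (f a)) : Measurable f := by
  refine measurable_generateFrom ?_
  rintro _ ⟨Δ, m, hb, hm, rfl⟩
  exact h Δ hb hm (measurableSet_singleton m)

theorem count_eq_zero {Δ : Set (Pt d)} (hb : Bornology.IsBounded Δ) {η : Config d} :
    count Δ η = 0 ↔ η.1 ∩ Δ = ∅ :=
  Set.ncard_eq_zero (η.2 Δ hb)

theorem measurableSet_outside {Δ : Set (Pt d)} (hb : Bornology.IsBounded Δ)
    (hm : MeasurableSet Δ) : MeasurableSet (outside Δ) := by
  have : outside Δ = count Δ ⁻¹' {0} := by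
    ext η
    rw [Set.mem_preimage, Set.mem_singleton_iff, count_eq_zero hb, ← Set.disjoint_iff_inter_eq_empty,
      ← Set.subset_compl_iff_disjoint_right]
    rfl
  rw [this]
  exact measurable_count hb hm (measurableSet_singleton 0)

theorem measurable_restrict {Δ : Set (Pt d)} (hm : MeasurableSet Δ) :
    Measurable fun η : Config d => η.restrict Δ := by
  refine measurable_of_count fun Δ' hb' hm' => ?_
  have : (fun η : Config d => count Δ' (η.restrict Δ)) = count (Δ ∩ Δ') := by
    ext η
    simp only [count, restrict, Set.inter_assoc]
  rw [this]
  exact measurable_count (hb'.subset Set.inter_subset_right) (hm.inter hm')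

/-- Local finiteness isolates `x` from the other points of `η`, so membership is detected by small
balls around a countable dense set. This expresses it through countably many generating events,
which gives joint measurability in `(x, η)`. -/
theorem mem_iff_count_ball_ne_zero (x : Pt d) (η : Config d) :
    x ∈ η.1 ↔ ∀ i n : ℕ, dist x (TopologicalSpace.denseSeq (Pt d) i) < 1 / ((n : ℝ) + 1) →
      count (Metric.ball (TopologicalSpace.denseSeq (Pt d) i) (1 / ((n : ℝ) + 1))) η ≠ 0 := by
  constructor
  · intro hx i n h h0
    rw [count_eq_zero Metric.isBounded_ball] at h0
    exact Set.eq_empty_iff_forall_notMem.mp h0 x ⟨hx, h⟩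
  · intro h
    by_contra hx
    have hfin := η.2 (Metric.ball x 1) Metric.isBounded_ball
    have hnot : x ∈ (η.1 ∩ Metric.ball x 1)ᶜ := fun h => hx h.1
    obtain ⟨ε, hε, hsub⟩ := Metric.isOpen_iff.mp hfin.isClosed.isOpen_compl x hnot
    -- Two points of a ball of radius `1/(n+1)` are at distance less than `2/(n+1)`; this choice
    -- keeps that below both `ε` and `1`.
    obtain ⟨n, hn⟩ := exists_nat_one_div_lt (show 0 < min (ε / 2) (1 / 2) by positivity)
    obtain ⟨i, hi⟩ := (TopologicalSpace.denseRange_denseSeq (Pt d)).exists_dist_lt x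
      (show 0 < 1 / ((n : ℝ) + 1) by positivity)
    have := h i n hi
    rw [Ne, count_eq_zero Metric.isBounded_ball, ← Ne, ← Set.nonempty_iff_ne_empty] at this
    obtain ⟨y, hy, hyb⟩ := this
    have hd : dist y x < min (2 * (ε / 2)) (2 * (1 / 2)) := by
      have h1 := dist_triangle_right y x (TopologicalSpace.denseSeq (Pt d) i)
      rw [Metric.mem_ball] at hyb
      have h2 := lt_min_iff.mp hn
      refine lt_min ?_ ?_ <;> linarith
    have hd := lt_min_iff.mp hd
    exact hsub (Metric.mem_ball.mpr (by linarith : dist y x < ε))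
      ⟨hy, Metric.mem_ball.mpr (by linarith : dist y x < 1)⟩

theorem measurableSet_mem : MeasurableSet {p : Pt d × Config d | p.1 ∈ p.2.1} := by
  simp only [mem_iff_count_ball_ne_zero, Set.ofPred_forall]
  refine MeasurableSet.iInter fun i => MeasurableSet.iInter fun n => ?_
  have h1 : MeasurableSet {p : Pt d × Config d |
      dist p.1 (TopologicalSpace.denseSeq (Pt d) i) < 1 / ((n : ℝ) + 1)} :=
    measurableSet_lt (measurable_fst.dist measurable_const) measurable_const
  have h2 : MeasurableSet {p : Pt d × Config d |
      count (Metric.ball (TopologicalSpace.denseSeq (Pt d) i) (1 / ((n : ℝ) + 1))) p.2 ≠ 0} :=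
    ((measurable_count Metric.isBounded_ball measurableSet_ball).comp measurable_snd)
      (measurableSet_singleton 0).compl
  convert h1.compl.union h2 using 1
  ext p
  simp only [ne_eq, Set.mem_ofPred_eq, Set.mem_union, Set.mem_compl_iff, imp_iff_not_or]

open Classical in
-- Configurations are sets, so a point already present adds nothing to the count. This is why
-- measurability of adding a point requires `measurableSet_mem`.
theorem count_single_union {Δ : Set (Pt d)} (hb : Bornology.IsBounded Δ) (x : Pt d)
    (η : Config d) :
    count Δ ((single x).union η) = count Δ η + if x ∈ Δ ∧ x ∉ η.1 then 1 else 0 := by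
  have hfin := η.2 Δ hb
  simp only [count, union, single, Set.union_inter_distrib_right]
  by_cases hx : x ∈ Δ
  · have h1 : ({x} : Set (Pt d)) ∩ Δ = {x} := by simpa using hx
    rw [h1, Set.singleton_union]
    by_cases hη : x ∈ η.1
    · rw [Set.insert_eq_of_mem (show x ∈ η.1 ∩ Δ from ⟨hη, hx⟩)]; simp [hη]
    · rw [Set.ncard_insert_of_notMem (fun h => hη h.1) hfin]; simp [hη, hx]
  · have h1 : ({x} : Set (Pt d)) ∩ Δ = ∅ := by simpa using hx
    rw [h1, Set.empty_union]; simp [hx]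

theorem measurable_single_union :
    Measurable fun p : Pt d × Config d => (single p.1).union p.2 := by
  classical
  refine measurable_of_count fun Δ hb hm => ?_
  simp only [count_single_union hb]
  refine ((measurable_count hb hm).comp measurable_snd).add
    (Measurable.ite ?_ measurable_const measurable_const)
  exact (measurable_fst hm).inter measurableSet_mem.compl

theorem ofTuple_zero_union (x : Fin 0 → Pt d) (η : Config d) : (ofTuple x).union η = η :=
  ext_carrier (by simp [union, ofTuple, Set.range_eq_empty])

theorem union_ofTuple_zero (x : Fin 0 → Pt d) (η : Config d) : η.union (ofTuple x) = η :=
  ext_carrier (by simp [union, ofTuple, Set.range_eq_empty])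

theorem union_assoc (ξ ζ η : Config d) : (ξ.union ζ).union η = ξ.union (ζ.union η) :=
  ext_carrier (Set.union_assoc _ _ _)

theorem union_comm (ξ ζ : Config d) : ξ.union ζ = ζ.union ξ :=
  ext_carrier (Set.union_comm _ _)

theorem ofTuple_succ {n : ℕ} (x : Fin (n + 1) → Pt d) :
    ofTuple x = (single (x 0)).union (ofTuple (Fin.tail x)) := by
  refine ext_carrier ?_
  conv_lhs => rw [← Fin.cons_self_tail x]
  exact (Fin.range_cons _ _).trans (Set.insert_eq _ _)

theorem ofTuple_cons {n : ℕ} (a : Pt d) (x : Fin n → Pt d) :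
    ofTuple (Fin.cons a x : Fin (n + 1) → Pt d) = (single a).union (ofTuple x) := by
  simp [ofTuple_succ]

theorem measurable_ofTuple_union (n : ℕ) :
    Measurable fun p : (Fin n → Pt d) × Config d => (ofTuple p.1).union p.2 := by
  induction n with
  | zero => simpa only [ofTuple_zero_union] using measurable_snd
  | succ n ih =>
    simp only [ofTuple_succ, union_assoc]
    have h1 : Measurable fun p : (Fin (n + 1) → Pt d) × Config d =>
        (ofTuple (Fin.tail p.1)).union p.2 :=
      ih.comp ((measurable_pi_lambda _ fun i =>
        (measurable_pi_apply i.succ).comp measurable_fst).prodMk measurable_snd)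
    have h0 : Measurable fun p : (Fin (n + 1) → Pt d) × Config d => p.1 0 :=
      (measurable_pi_apply 0).comp measurable_fst
    exact measurable_single_union.comp (h0.prodMk h1)

theorem measurable_ofTuple (n : ℕ) : Measurable fun x : Fin n → Pt d => ofTuple x := by
  have h := (measurable_ofTuple_union (d := d) n).comp
    (measurable_id.prodMk (measurable_const (a := ofTuple (Fin.elim0 : Fin 0 → Pt d))))
  simpa only [Function.comp_def, id, union_ofTuple_zero] using h

theorem ofTuple_finite {n : ℕ} (x : Fin n → Pt d) : (ofTuple x).1.Finite := Set.finite_range x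

end Config

variable {d : ℕ}

/-- A lower limit of measurable functions is measurable whether or not the limit exists, so
temperedness plays no role here. -/
theorem measurable_boltzmann {α : Type*} [MeasurableSpace α] {Λ : ℕ → Set (Pt d)}
    (hΛ : IsExhausting Λ) {H : Config d → EReal} (hH : Measurable H)
    {n : ℕ} {x : α → Fin n → Pt d} (hx : Measurable x) {η : α → Config d} (hη : Measurable η) :
    Measurable fun a => boltzmann Λ H (Config.ofTuple (x a)) (η a) := by
  have h1 : Measurable fun a => H (Config.ofTuple (x a)) :=
    hH.comp ((Config.measurable_ofTuple n).comp hx)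
  have hr : ∀ m, Measurable fun a => (η a).restrict (Λ m) := fun m =>
    (Config.measurable_restrict (hΛ.measurable m)).comp hη
  have hu : ∀ m, Measurable fun a => H ((Config.ofTuple (x a)).union ((η a).restrict (Λ m))) :=
    fun m => hH.comp ((Config.measurable_ofTuple_union n).comp (hx.prodMk (hr m)))
  have h2 : ∀ m, Measurable fun a => mutualEnergy H (Config.ofTuple (x a)) ((η a).restrict (Λ m)) := by
    intro m
    classical
    refine Measurable.ite ((hu m) (measurableSet_singleton ⊤)) measurable_const ?_
    simp only [sub_eq_add_neg]
    exact ((hu m).add h1.neg).add (hH.comp (hr m)).neg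
  have h3 : Measurable fun a => interaction Λ H (Config.ofTuple (x a)) (η a) :=
    Measurable.liminf h2
  exact (h1.add h3).neg.ereal_exp

end

/-! ### Splitting integrals over tuples of points -/

section

section Split

variable {X ι κ τ : Type*} [MeasurableSpace X]

/-- Splitting the coordinates of a tuple along `ι ⊕ κ ≃ τ`. -/
def splitEquiv (X : Type*) [MeasurableSpace X] (e : ι ⊕ κ ≃ τ) : (τ → X) ≃ᵐ (ι → X) × (κ → X) :=
  (MeasurableEquiv.piCongrLeft (fun _ => X) e).symm.trans
    (MeasurableEquiv.sumPiEquivProdPi fun _ => X)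

theorem splitEquiv_apply (e : ι ⊕ κ ≃ τ) (z : τ → X) :
    splitEquiv X e z = (fun i => z (e (Sum.inl i)), fun j => z (e (Sum.inr j))) := rfl

variable [Fintype ι] [Fintype κ] [Fintype τ]

theorem measurePreserving_splitEquiv (ν : Measure X) [SigmaFinite ν] (e : ι ⊕ κ ≃ τ) :
    MeasurePreserving (splitEquiv X e) (Measure.pi fun _ => ν)
      ((Measure.pi fun _ => ν).prod (Measure.pi fun _ => ν)) :=
  ((measurePreserving_piCongrLeft (fun _ : τ => ν) e).symm _).trans
    (measurePreserving_sumPiEquivProdPi fun _ => ν)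

theorem lintegral_split_mul (ν : Measure X) [SigmaFinite ν] (e : ι ⊕ κ ≃ τ)
    {f : (ι → X) → ℝ≥0∞} {g : (κ → X) → ℝ≥0∞} (hf : Measurable f) (hg : Measurable g) :
    ∫⁻ z, f (fun i => z (e (Sum.inl i))) * g (fun j => z (e (Sum.inr j))) ∂Measure.pi (fun _ => ν) =
      (∫⁻ y, f y ∂Measure.pi fun _ => ν) * ∫⁻ y, g y ∂Measure.pi fun _ => ν := by
  rw [← lintegral_prod_mul hf.aemeasurable hg.aemeasurable,
    ← (measurePreserving_splitEquiv ν e).lintegral_comp_emb (splitEquiv X e).measurableEmbedding]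
  rfl

theorem integral_split_mul (ν : Measure X) [SigmaFinite ν] (e : ι ⊕ κ ≃ τ)
    (f : (ι → X) → ℝ) (g : (κ → X) → ℝ) :
    ∫ z, f (fun i => z (e (Sum.inl i))) * g (fun j => z (e (Sum.inr j))) ∂Measure.pi (fun _ => ν) =
      (∫ y, f y ∂Measure.pi fun _ => ν) * ∫ y, g y ∂Measure.pi fun _ => ν := by
  rw [← integral_prod_mul,
    ← (measurePreserving_splitEquiv ν e).integral_comp (splitEquiv X e).measurableEmbedding]
  rfl

theorem integrable_split_mul (ν : Measure X) [SigmaFinite ν] (e : ι ⊕ κ ≃ τ)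
    {f : (ι → X) → ℝ} {g : (κ → X) → ℝ} (hf : Integrable f (Measure.pi fun _ => ν))
    (hg : Integrable g (Measure.pi fun _ => ν)) :
    Integrable (fun z : τ → X => f (fun i => z (e (Sum.inl i))) * g (fun j => z (e (Sum.inr j))))
      (Measure.pi fun _ => ν) :=
  (measurePreserving_splitEquiv ν e).integrable_comp_of_integrable (hf.mul_prod hg)

end Split

variable {d : ℕ}

theorem box_eq_pi (Δ : Set (Pt d)) (n : ℕ) : box Δ n = Set.univ.pi fun _ => Δ := by
  ext x; simp [box]

theorem measurableSet_box {Δ : Set (Pt d)} (hm : MeasurableSet Δ) (n : ℕ) :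
    MeasurableSet (box Δ n) := by
  rw [box_eq_pi]; exact MeasurableSet.univ_pi fun _ => hm

theorem volume_restrict_box (Δ : Set (Pt d)) (n : ℕ) :
    (volume : Measure (Fin n → Pt d)).restrict (box Δ n) =
      Measure.pi fun _ => volume.restrict Δ := by
  rw [box_eq_pi, volume_pi, Measure.restrict_pi_pi]

theorem box_mono {Δ Δ' : Set (Pt d)} (h : Δ ⊆ Δ') (n : ℕ) : box Δ n ⊆ box Δ' n :=
  fun _ hx i => h (hx i)

theorem Config.union_ofTuple_ofTuple {m n l : ℕ} (e : Fin m ⊕ Fin n ≃ Fin l) (z : Fin l → Pt d) :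
    (Config.ofTuple fun i => z (e (Sum.inl i))).union (Config.ofTuple fun j => z (e (Sum.inr j))) =
      Config.ofTuple z := by
  refine Config.ext_carrier ?_
  ext p
  simp only [union, ofTuple, Set.mem_union, Set.mem_range]
  rw [← e.exists_congr_right, Sum.exists]

/-- Measurability of `φ` is required only along tuples: this is the form in which it is available
for the integrals of Boltzmann factors used later. -/
theorem measurable_union_ofTuple {φ : Config d → ℝ≥0∞}
    (hφ : ∀ n, Measurable fun z : Fin n → Pt d => φ (Config.ofTuple z)) (m n : ℕ) :
    Measurable fun p : (Fin m → Pt d) × (Fin n → Pt d) =>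
      φ ((Config.ofTuple p.1).union (Config.ofTuple p.2)) := by
  have h := (hφ (m + n)).comp (splitEquiv (Pt d) finSumFinEquiv).symm.measurable
  convert h using 2 with p
  obtain ⟨z, rfl⟩ := (splitEquiv (Pt d) finSumFinEquiv).surjective p
  rw [Function.comp_apply, MeasurableEquiv.symm_apply_apply]
  simp only [splitEquiv_apply, Config.union_ofTuple_ofTuple]

theorem setLIntegral_split {φ : Config d → ℝ≥0∞}
    (hφ : ∀ n, Measurable fun z : Fin n → Pt d => φ (Config.ofTuple z)) {m n l : ℕ}
    (e : Fin m ⊕ Fin n ≃ Fin l) {A B : Set (Pt d)} (hA : MeasurableSet A) (hB : MeasurableSet B) :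
    ∫⁻ z in {z : Fin l → Pt d | (fun i => z (e (Sum.inl i))) ∈ box A m ∧
        (fun j => z (e (Sum.inr j))) ∈ box B n}, φ (Config.ofTuple z) =
      ∫⁻ y in box A m, ∫⁻ y' in box B n, φ ((Config.ofTuple y).union (Config.ofTuple y')) := by
  have hmeas := measurable_union_ofTuple hφ m n
  have h := (measurePreserving_splitEquiv (volume : Measure (Pt d)) e).setLIntegral_comp_preimage
    ((measurableSet_box hA m).prod (measurableSet_box hB n)) hmeas
  simp only [splitEquiv_apply, Config.union_ofTuple_ofTuple] at h
  refine Eq.trans ?_ (h.trans ?_)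
  · rfl
  · rw [setLIntegral_prod _ hmeas.aemeasurable]
    rfl

theorem setLIntegral_box_add {φ : Config d → ℝ≥0∞}
    (hφ : ∀ n, Measurable fun z : Fin n → Pt d => φ (Config.ofTuple z)) (m n : ℕ)
    {Δ : Set (Pt d)} (hΔ : MeasurableSet Δ) :
    ∫⁻ z in box Δ (m + n), φ (Config.ofTuple z) =
      ∫⁻ y in box Δ m, ∫⁻ y' in box Δ n, φ ((Config.ofTuple y).union (Config.ofTuple y')) := by
  rw [← setLIntegral_split hφ finSumFinEquiv hΔ hΔ]
  congr 2
  ext z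
  simp only [box, Set.mem_ofPred_eq]
  rw [← finSumFinEquiv.forall_congr_right, Sum.forall]

/-- Sort the tuples by the set of indices whose points fall in `Δ`. Since `φ` sees only the
configuration, an index set contributes through its cardinality alone, whence the binomial
coefficient. -/
theorem setLIntegral_box_sdiff {φ : Config d → ℝ≥0∞}
    (hφ : ∀ n, Measurable fun z : Fin n → Pt d => φ (Config.ofTuple z))
    {Δ Δ' : Set (Pt d)} (hΔ : MeasurableSet Δ) (hΔ' : MeasurableSet Δ') (hsub : Δ ⊆ Δ') (n : ℕ) :
    ∫⁻ z in box Δ' n, φ (Config.ofTuple z) =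
      ∑ k ∈ Finset.range (n + 1), (n.choose k : ℝ≥0∞) *
        ∫⁻ y in box Δ k, ∫⁻ y' in box (Δ' \ Δ) (n - k),
          φ ((Config.ofTuple y).union (Config.ofTuple y')) := by
  classical
  set A : Finset (Fin n) → Set (Fin n → Pt d) := fun S =>
    {z | (fun i => z (finSumEquivOfFinset (s := S) rfl rfl (Sum.inl i))) ∈ box Δ S.card ∧
        (fun j => z (finSumEquivOfFinset (s := S) rfl rfl (Sum.inr j))) ∈ box (Δ' \ Δ) Sᶜ.card}
    with hA
  have hmem : ∀ S z, z ∈ A S ↔ (∀ i ∈ S, z i ∈ Δ) ∧ ∀ i ∈ Sᶜ, z i ∈ Δ' \ Δ := by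
    intro S z
    simp only [hA, box, Set.mem_ofPred_eq, finSumEquivOfFinset_inl, finSumEquivOfFinset_inr]
    refine and_congr ⟨fun h i hi => ?_, fun h i => h _ (Finset.orderEmbOfFin_mem _ _ _)⟩
      ⟨fun h i hi => ?_, fun h i => h _ (Finset.orderEmbOfFin_mem _ _ _)⟩
    · have : i ∈ Set.range (S.orderEmbOfFin rfl) := by simpa using hi
      obtain ⟨j, rfl⟩ := this
      exact h j
    · have : i ∈ Set.range (Sᶜ.orderEmbOfFin rfl) := by
        rw [Finset.range_orderEmbOfFin]; exact hi
      obtain ⟨j, rfl⟩ := this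
      exact h j
  have hAm : ∀ S, MeasurableSet (A S) := fun S =>
    (splitEquiv (Pt d) (finSumEquivOfFinset (s := S) rfl rfl)).measurable
      ((measurableSet_box hΔ _).prod (measurableSet_box (hΔ'.diff hΔ) _))
  -- A tuple determines the index set of its piece, so the pieces are disjoint.
  have hfilter : ∀ S z, z ∈ A S → S = Finset.univ.filter fun i => z i ∈ Δ := by
    intro S z hz
    rw [hmem] at hz
    ext i
    simp only [Finset.mem_filter, Finset.mem_univ, true_and]
    refine ⟨hz.1 i, fun h => ?_⟩
    by_contra hi
    exact (hz.2 i (Finset.mem_compl.mpr hi)).2 h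
  have hunion : box Δ' n = ⋃ S, A S := by
    ext z
    rw [Set.mem_iUnion]
    constructor
    · intro hz
      refine ⟨Finset.univ.filter fun i => z i ∈ Δ, (hmem _ _).mpr ⟨fun i hi => ?_, fun i hi => ?_⟩⟩
      · simpa using hi
      · exact ⟨hz i, by simpa using hi⟩
    · rintro ⟨S, hz⟩ i
      rw [hmem] at hz
      by_cases hi : i ∈ S
      · exact hsub (hz.1 i hi)
      · exact (hz.2 i (Finset.mem_compl.mpr hi)).1
  have hdisj : Pairwise (Function.onFun Disjoint A) := by
    intro S T hST
    refine Set.disjoint_left.mpr fun z hS hT => hST ?_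
    rw [hfilter S z hS, ← hfilter T z hT]
  rw [hunion, lintegral_iUnion hAm hdisj, tsum_fintype]
  have : ∀ S : Finset (Fin n), ∫⁻ z in A S, φ (Config.ofTuple z) =
      ∫⁻ y in box Δ S.card, ∫⁻ y' in box (Δ' \ Δ) (n - S.card),
          φ ((Config.ofTuple y).union (Config.ofTuple y')) := by
    intro S
    rw [setLIntegral_split hφ _ hΔ (hΔ'.diff hΔ), Finset.card_compl, Fintype.card_fin]
  simp only [this]
  have h := Finset.sum_powerset_apply_card (x := (Finset.univ : Finset (Fin n))) (fun k => ∫⁻ y in box Δ k, ∫⁻ y' in box (Δ' \ Δ) (n - k),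
    φ ((Config.ofTuple y).union (Config.ofTuple y')))
  rw [Finset.powerset_univ] at h
  rw [h, Finset.card_univ, Fintype.card_fin]
  simp only [nsmul_eq_mul]

end

/-! ### Heredity and additivity of the energy -/

section

variable {d : ℕ} {Λ : ℕ → Set (Pt d)} {H : Config d → EReal}

/-- Heredity is formulated for one added particle; this extends it to finitely many. The two
inclusions on `ζ'` keep the intermediate configurations inside `ξ ∪ ζ`, so finiteness and
disjointness from a boundary condition persist through the induction. -/
theorem Config.single_union_induction {ξ : Config d} (hξ : ξ.1.Finite) {p : Config d → Prop}
    {ζ : Config d} (h0 : p ζ) (hstep : ∀ x ∈ ξ.1, ∀ ζ' : Config d, ζ'.1 ⊆ ξ.1 ∪ ζ.1 → ζ.1 ⊆ ζ'.1 →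
      p ζ' → p (ζ'.union (single x))) : p (ξ.union ζ) := by
  have key : ∀ s : Set (Pt d), s.Finite → s ⊆ ξ.1 →
      ∀ ζ' : Config d, ζ'.1 = s ∪ ζ.1 → p ζ' := by
    intro s hs
    induction s, hs using Set.Finite.induction_on with
    | empty =>
      intro _ ζ' h
      rw [show ζ' = ζ from Config.ext_carrier (by simpa using h)]
      exact h0
    | @insert a s ha hs ih =>
      intro hsub ζ' h
      have hs' : s ⊆ ξ.1 := (Set.subset_insert a s).trans hsub
      let ζ₁ : Config d := ⟨s ∪ ζ.1, fun Δ hΔ => by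
        rw [Set.union_inter_distrib_right]
        exact (hs.subset Set.inter_subset_left).union (ζ.2 Δ hΔ)⟩
      have h1 := hstep a (hsub (Set.mem_insert a s)) ζ₁
        (Set.union_subset_union_left _ hs') Set.subset_union_right (ih hs' ζ₁ rfl)
      rw [show ζ' = ζ₁.union (single a) from Config.ext_carrier ?_]
      · exact h1
      · rw [h, Set.insert_union, Set.insert_eq, Set.union_comm]; rfl
  exact key ξ.1 hξ subset_rfl _ rfl

theorem IsHamiltonian.union_eq_top (hH : IsHamiltonian H) {ξ ζ : Config d} (hξ : ξ.1.Finite)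
    (hζ : H ζ = ⊤) : H (ξ.union ζ) = ⊤ :=
  Config.single_union_induction hξ (p := fun ζ => H ζ = ⊤) hζ
    fun x _ ζ' _ _ h => hH.hereditary ζ' x h

theorem IsTempered.interaction_ne_bot {η : Config d} (h : IsTempered Λ H η) {ξ : Config d}
    (hξ : ξ.1.Finite) (hd : Disjoint ξ.1 η.1) : interaction Λ H ξ η ≠ ⊥ := by
  obtain ⟨w, hw, hlim⟩ := h.exists_limit ξ hξ hd
  rwa [interaction, hlim.liminf_eq]

theorem IsTempered.tendsto {η : Config d} (h : IsTempered Λ H η) {ξ : Config d}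
    (hξ : ξ.1.Finite) (hd : Disjoint ξ.1 η.1) :
    Tendsto (fun m => mutualEnergy H ξ (η.restrict (Λ m))) atTop (𝓝 (interaction Λ H ξ η)) := by
  obtain ⟨w, -, hlim⟩ := h.exists_limit ξ hξ hd
  rwa [interaction, hlim.liminf_eq]

theorem IsTempered.interaction_union_eq_top {η : Config d} (h : IsTempered Λ H η) {ξ ζ : Config d}
    (hξ : ξ.1.Finite) (hζ : ζ.1.Finite) (hdξ : Disjoint ξ.1 η.1) (hdζ : Disjoint ζ.1 η.1)
    (htop : interaction Λ H ζ η = ⊤) : interaction Λ H (ξ.union ζ) η = ⊤ := by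
  refine Config.single_union_induction hξ (p := fun ζ => interaction Λ H ζ η = ⊤) htop
    fun x hx ζ' hsub _ h' => h.hereditary ζ' ((hξ.union hζ).subset hsub) ?_ x ?_ h'
  · exact (Disjoint.union_left hdξ hdζ).mono_left hsub
  · exact fun hxη => Set.disjoint_left.mp hdξ hx hxη

/-- In `EReal` one has `⊤ + ⊥ = ⊥`, so an infinite energy kills the Boltzmann factor only when the
interaction is not `⊥`. -/
theorem boltzmann_eq_zero_of_hamiltonian (ξ : Config d) {η : Config d}
    (hξ : H ξ = ⊤) (hW : interaction Λ H ξ η ≠ ⊥) : boltzmann Λ H ξ η = 0 := by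
  rw [boltzmann, hξ, EReal.top_add_of_ne_bot hW]; simp

theorem boltzmann_eq_zero_of_interaction (hH : IsHamiltonian H) (ξ : Config d) {η : Config d}
    (hW : interaction Λ H ξ η = ⊤) : boltzmann Λ H ξ η = 0 := by
  rw [boltzmann, hW, EReal.add_top_of_ne_bot (hH.ne_bot ξ)]; simp

theorem Config.restrict_union (ζ η : Config d) (Δ : Set (Pt d)) :
    (ζ.union η).restrict Δ = (ζ.restrict Δ).union (η.restrict Δ) :=
  ext_carrier (Set.union_inter_distrib_right _ _ _)

theorem IsExhausting.eventually_restrict_eq (hΛ : IsExhausting Λ) {ζ : Config d}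
    (hζ : ζ.1.Finite) : ∀ᶠ m in atTop, ζ.restrict (Λ m) = ζ := by
  obtain ⟨m₀, hm₀⟩ := hΛ.exhausts ζ.1 hζ.isBounded
  filter_upwards [eventually_ge_atTop m₀] with m hm
  exact Config.ext_carrier (Set.inter_eq_left.mpr (hm₀.trans (hΛ.mono hm)))

/-- Additivity of the energy: the Boltzmann factor of `ξ` in the field of `ζ ∪ η`, times that of
`ζ` in the field of `η`, is the Boltzmann factor of `ξ ∪ ζ` in the field of `η`. -/
theorem boltzmann_mul_boltzmann (hΛ : IsExhausting Λ) (hH : IsHamiltonian H) {η : Config d}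
    (hη : IsTempered Λ H η) {ξ ζ : Config d} (hξ : ξ.1.Finite) (hζ : ζ.1.Finite)
    (hdξ : Disjoint ξ.1 η.1) (hdζ : Disjoint ζ.1 η.1) :
    boltzmann Λ H ξ (ζ.union η) * boltzmann Λ H ζ η = boltzmann Λ H (ξ.union ζ) η := by
  have hfin : (ξ.union ζ).1.Finite := hξ.union hζ
  have hd : Disjoint (ξ.union ζ).1 η.1 := hdξ.union_left hdζ
  have hw1 := hη.interaction_ne_bot hζ hdζ
  have hw2 := hη.interaction_ne_bot hfin hd
  have hrestr : ∀ᶠ m in atTop, (ζ.union η).restrict (Λ m) = ζ.union (η.restrict (Λ m)) := by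
    filter_upwards [hΛ.eventually_restrict_eq hζ] with m hm
    rw [Config.restrict_union, hm]
  -- In the three hard-core cases both sides vanish by heredity. Afterwards the energies of `ξ`,
  -- `ζ`, `ξ ∪ ζ` and the interaction of `ζ` with `η` are real, and only the interaction of `ξ ∪ ζ`
  -- may still be infinite.
  by_cases hζtop : H ζ = ⊤
  · rw [boltzmann_eq_zero_of_hamiltonian ζ hζtop hw1, mul_zero,
      boltzmann_eq_zero_of_hamiltonian _ (hH.union_eq_top hξ hζtop) hw2]
  by_cases hw1top : interaction Λ H ζ η = ⊤
  · rw [boltzmann_eq_zero_of_interaction hH ζ hw1top, mul_zero,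
      boltzmann_eq_zero_of_interaction hH _ (hη.interaction_union_eq_top hξ hζ hdξ hdζ hw1top)]
  by_cases hut : H (ξ.union ζ) = ⊤
  · have hW : interaction Λ H ξ (ζ.union η) = ⊤ := by
      refine Tendsto.liminf_eq (Tendsto.congr' ?_ tendsto_const_nhds)
      filter_upwards [hrestr] with m hm
      have hfinm : (η.restrict (Λ m)).1.Finite := η.2 _ (hΛ.bounded m)
      have : H (ξ.union (ζ.union (η.restrict (Λ m)))) = ⊤ := by
        rw [← Config.union_assoc, Config.union_comm]
        exact hH.union_eq_top hfinm hut
      rw [hm, mutualEnergy, if_pos this]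
    rw [boltzmann_eq_zero_of_interaction hH ξ hW, zero_mul,
      boltzmann_eq_zero_of_hamiltonian _ hut hw2]
  have hξtop : H ξ ≠ ⊤ := fun h => hut (by
    rw [Config.union_comm]; exact hH.union_eq_top hζ h)
  obtain ⟨a, ha⟩ : ∃ a : ℝ, H ξ = a := ⟨_, (EReal.coe_toReal hξtop (hH.ne_bot _)).symm⟩
  obtain ⟨b, hb⟩ : ∃ b : ℝ, H ζ = b := ⟨_, (EReal.coe_toReal hζtop (hH.ne_bot _)).symm⟩
  obtain ⟨c, hc⟩ : ∃ c : ℝ, H (ξ.union ζ) = c := ⟨_, (EReal.coe_toReal hut (hH.ne_bot _)).symm⟩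
  obtain ⟨w₁, hw₁⟩ : ∃ w : ℝ, interaction Λ H ζ η = w := ⟨_, (EReal.coe_toReal hw1top hw1).symm⟩
  have hlim1 := hη.tendsto hζ hdζ
  have hlim2 := hη.tendsto hfin hd
  have hW : interaction Λ H ξ (ζ.union η) =
      interaction Λ H (ξ.union ζ) η + (((c - a - b : ℝ) : EReal) - interaction Λ H ζ η) := by
    -- With a cutoff the claim is a telescoping identity among Hamiltonians, valid once `Λ m`
    -- contains `ζ` and the cut-off interaction of `ζ` is finite. The constant `c - a - b` is the
    -- mutual energy of `ξ` and `ζ`.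
    refine Tendsto.liminf_eq (Tendsto.congr' (f₁ := fun m =>
      mutualEnergy H (ξ.union ζ) (η.restrict (Λ m)) +
        (((c - a - b : ℝ) : EReal) - mutualEnergy H ζ (η.restrict (Λ m)))) ?_ ?_)
    · filter_upwards [hrestr, hlim1.eventually_ne hw1top] with m hm hne
      set ηm := η.restrict (Λ m) with hηm
      have hζm : H (ζ.union ηm) ≠ ⊤ := fun h => hne (by rw [mutualEnergy, if_pos h])
      have hm' : H ηm ≠ ⊤ := fun h => hζm (hH.union_eq_top hζ h)
      obtain ⟨e, he⟩ : ∃ e : ℝ, H (ζ.union ηm) = e :=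
        ⟨_, (EReal.coe_toReal hζm (hH.ne_bot _)).symm⟩
      obtain ⟨f, hf⟩ : ∃ f : ℝ, H ηm = f := ⟨_, (EReal.coe_toReal hm' (hH.ne_bot _)).symm⟩
      simp only [hm, mutualEnergy, Config.union_assoc, hc, hb, he, hf, ha]
      rw [if_neg (EReal.coe_ne_top e)]
      by_cases htop : H (ξ.union (ζ.union ηm)) = ⊤
      · rw [if_pos htop, if_pos htop]
        norm_cast
      · obtain ⟨g, hg⟩ : ∃ g : ℝ, H (ξ.union (ζ.union ηm)) = g :=
          ⟨_, (EReal.coe_toReal htop (hH.ne_bot _)).symm⟩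
        rw [if_neg htop, if_neg htop, hg]
        norm_cast
        ring
    -- Addition on `EReal` is discontinuous at `(⊤, ⊥)`; finiteness of the second summand avoids
    -- this.
    · have hcont : ContinuousAt (fun p : EReal × EReal => p.1 + p.2)
          (interaction Λ H (ξ.union ζ) η, ((c - a - b : ℝ) : EReal) - interaction Λ H ζ η) := by
        rw [hw₁, ← EReal.coe_sub]
        exact EReal.continuousAt_add (Or.inr (EReal.coe_ne_bot _)) (Or.inr (EReal.coe_ne_top _))
      have hcont' : ContinuousAt (fun p : EReal × EReal => p.1 + p.2)
          (((c - a - b : ℝ) : EReal), - interaction Λ H ζ η) :=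
        EReal.continuousAt_add (Or.inl (EReal.coe_ne_top _)) (Or.inl (EReal.coe_ne_bot _))
      have hsub : Tendsto (fun m => ((c - a - b : ℝ) : EReal) - mutualEnergy H ζ (η.restrict (Λ m)))
          atTop (𝓝 (((c - a - b : ℝ) : EReal) - interaction Λ H ζ η)) :=
        hcont'.tendsto.comp (tendsto_const_nhds.prodMk_nhds
          (continuous_neg.continuousAt.tendsto.comp hlim1))
      exact hcont.tendsto.comp (hlim2.prodMk_nhds hsub)
  rw [boltzmann, boltzmann, boltzmann, ← EReal.exp_add, hW, ha, hb, hc, hw₁]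
  congr 1
  by_cases h2 : interaction Λ H (ξ.union ζ) η = ⊤
  · rw [h2]
    norm_cast
  · obtain ⟨w₂, hw₂⟩ : ∃ w : ℝ, interaction Λ H (ξ.union ζ) η = w :=
      ⟨_, (EReal.coe_toReal h2 hw2).symm⟩
    rw [hw₂]
    norm_cast
    ring

end

/-! ### Volume independence of the correlation functions -/

section

variable {d : ℕ}

theorem Config.ofTuple_append {m n : ℕ} (x : Fin m → Pt d) (y : Fin n → Pt d) :
    ofTuple (Fin.append x y) = (ofTuple x).union (ofTuple y) := by
  have h := union_ofTuple_ofTuple finSumFinEquiv (Fin.append x y)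
  simpa using h.symm

theorem append_mem_box {m n : ℕ} {Δ : Set (Pt d)} {x : Fin m → Pt d} {y : Fin n → Pt d}
    (hx : x ∈ box Δ m) (hy : y ∈ box Δ n) : Fin.append x y ∈ box Δ (m + n) := by
  intro i
  induction i using Fin.addCases with
  | left i => simpa using hx i
  | right i => simpa using hy i

theorem measurable_append {α : Type*} [MeasurableSpace α] {m n : ℕ} {x : α → Fin m → Pt d}
    {y : α → Fin n → Pt d} (hx : Measurable x) (hy : Measurable y) :
    Measurable fun a => Fin.append (x a) (y a) := by
  refine measurable_pi_lambda _ fun i => ?_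
  induction i using Fin.addCases with
  | left i => simpa [Function.comp_def] using (measurable_pi_apply i).comp hx
  | right i => simpa [Function.comp_def] using (measurable_pi_apply i).comp hy

/-- The weight `e^{nμ} / n!` of an `n`-particle configuration. -/
def weight (μ : ℝ) (n : ℕ) : ℝ≥0∞ := ENNReal.ofReal (Real.exp (n * μ) / n.factorial)

theorem weight_ne_top (μ : ℝ) (n : ℕ) : weight μ n ≠ ∞ := ENNReal.ofReal_ne_top

theorem weight_eq (μ : ℝ) (n : ℕ) :
    weight μ n = ((n.factorial : ℕ) : ℝ≥0∞)⁻¹ * ENNReal.ofReal (Real.exp (n * μ)) := by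
  rw [weight, div_eq_inv_mul, ENNReal.ofReal_mul (by positivity),
    ENNReal.ofReal_inv_of_pos (by positivity), ENNReal.ofReal_natCast]

theorem weight_mul_weight (μ : ℝ) (k l : ℕ) :
    weight μ k * weight μ l = weight μ (k + l) * ((k + l).choose k : ℝ≥0∞) := by
  rw [weight, weight, weight, ← ENNReal.ofReal_mul (by positivity), ← ENNReal.ofReal_natCast,
    ← ENNReal.ofReal_mul (by positivity), Nat.cast_add_choose]
  congr 1
  push_cast
  rw [add_mul, Real.exp_add]
  have := Nat.factorial_ne_zero (k + l)
  have := Nat.factorial_ne_zero k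
  have := Nat.factorial_ne_zero l
  field_simp

theorem tsum_tsum_eq_tsum_sum_range (f : ℕ → ℕ → ℝ≥0∞) :
    ∑' k, ∑' l, f k l = ∑' n, ∑ k ∈ Finset.range (n + 1), f k (n - k) := by
  rw [← ENNReal.tsum_prod (f := f),
    ← Equiv.tsum_eq (Finset.HasAntidiagonal.sigmaAntidiagonalEquivProd (A := ℕ)) (fun p : ℕ × ℕ => f p.1 p.2),
    ENNReal.tsum_sigma']
  refine tsum_congr fun n => ?_
  rw [← Finset.Nat.sum_antidiagonal_eq_sum_range_succ f n, tsum_fintype,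
    ← Finset.sum_coe_sort (Finset.HasAntidiagonal.antidiagonal n)]
  rfl

variable (Λ : ℕ → Set (Pt d)) (μ : ℝ) (H : Config d → EReal) (P : Measure (Config d))

/-- The integral of the Boltzmann factor of `ξ` over the configurations outside `Δ`. -/
def outerIntegral (Δ : Set (Pt d)) (ξ : Config d) : ℝ≥0∞ :=
  ∫⁻ η in Config.outside Δ, boltzmann Λ H ξ η ∂P

/-- `∑_k e^{kμ}/k! ∫_{Δ^k} (outerIntegral of ξ ∪ {y}) dy`. -/
def grandIntegral (Δ : Set (Pt d)) (ξ : Config d) : ℝ≥0∞ :=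
  ∑' k : ℕ, weight μ k * ∫⁻ y in box Δ k, outerIntegral Λ H P Δ (ξ.union (Config.ofTuple y))

theorem janossy_eq (Δ : Set (Pt d)) (n : ℕ) (x : Fin n → Pt d) :
    janossy Λ μ H P Δ n x =
      ENNReal.ofReal (Real.exp (n * μ)) * outerIntegral Λ H P Δ (Config.ofTuple x) :=
  lintegral_const_mul' _ _ ENNReal.ofReal_ne_top

theorem corrIn_eq (Δ : Set (Pt d)) (n : ℕ) (x : Fin n → Pt d) :
    corrIn Λ μ H P Δ n x =
      ENNReal.ofReal (Real.exp (n * μ)) * grandIntegral Λ μ H P Δ (Config.ofTuple x) := by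
  rw [corrIn, grandIntegral, ← ENNReal.tsum_mul_left]
  refine tsum_congr fun k => ?_
  simp only [janossy_eq, Config.ofTuple_append]
  rw [lintegral_const_mul' _ _ ENNReal.ofReal_ne_top, weight_eq, Nat.cast_add, add_mul,
    Real.exp_add, ENNReal.ofReal_mul (by positivity)]
  ring

variable {Λ μ H P}

theorem measurable_outerIntegral [SFinite P] (hΛ : IsExhausting Λ) (hH : IsHamiltonian H)
    (Δ : Set (Pt d)) {α : Type*} [MeasurableSpace α] {n : ℕ} {x : α → Fin n → Pt d}
    (hx : Measurable x) : Measurable fun a => outerIntegral Λ H P Δ (Config.ofTuple (x a)) :=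
  Measurable.lintegral_prod_right'
    (f := fun p : α × Config d => boltzmann Λ H (Config.ofTuple (x p.1)) p.2)
    (measurable_boltzmann hΛ hH.measurable (hx.comp measurable_fst) measurable_snd)

/-- Apply the Ruelle equation in the larger volume `Δ'` to the Boltzmann factor of `x` restricted to
`Γ_{Δᶜ}`. The restriction forces the new points into `Δ' \ Δ`, and energy additivity merges the two
Boltzmann factors. -/
theorem outerIntegral_eq_tsum [SFinite P] (hΛ : IsExhausting Λ) (hH : IsHamiltonian H)
    (hG : IsGibbs Λ μ H P) {Δ Δ' : Set (Pt d)} (hb : Bornology.IsBounded Δ')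
    (hm : MeasurableSet Δ) (hm' : MeasurableSet Δ') (hsub : Δ ⊆ Δ') {n : ℕ} {x : Fin n → Pt d}
    (hx : x ∈ box Δ n) :
    outerIntegral Λ H P Δ (Config.ofTuple x) =
      ∑' k, weight μ k * ∫⁻ y in box (Δ' \ Δ) k,
        outerIntegral Λ H P Δ' ((Config.ofTuple x).union (Config.ofTuple y)) := by
  have hout := Config.measurableSet_outside (hb.subset hsub) hm
  have hout' := Config.measurableSet_outside hb hm'
  have hjoint : ∀ k, Measurable fun p : Config d × (Fin k → Pt d) =>
      boltzmann Λ H ((Config.ofTuple x).union (Config.ofTuple p.2)) p.1 := by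
    intro k
    simp only [← Config.ofTuple_append]
    exact measurable_boltzmann hΛ hH.measurable
      (measurable_append measurable_const measurable_snd) measurable_fst
  have hGm : Measurable ((Config.outside Δ).indicator (boltzmann Λ H (Config.ofTuple x))) :=
    (measurable_boltzmann hΛ hH.measurable measurable_const measurable_id).indicator hout
  rw [outerIntegral, ← lintegral_indicator hout, hG.ruelle_equation Δ' hb hm' _ hGm]
  have hpt : ∀ᵐ η ∂P, η ∈ Config.outside Δ' → ∀ k,
      ∫⁻ y in box Δ' k, (Config.outside Δ).indicator (boltzmann Λ H (Config.ofTuple x))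
          ((Config.ofTuple y).union η) * boltzmann Λ H (Config.ofTuple y) η =
        ∫⁻ y in box (Δ' \ Δ) k,
          boltzmann Λ H ((Config.ofTuple x).union (Config.ofTuple y)) η := by
    filter_upwards [hG.tempered] with η hη hηout k
    have hbox : box (Δ' \ Δ) k = box Δᶜ k ∩ box Δ' k := by
      ext y
      simp only [box, Set.mem_sdiff, Set.mem_ofPred_eq, Set.mem_inter_iff, Set.mem_compl_iff]
      exact ⟨fun h => ⟨fun i => (h i).2, fun i => (h i).1⟩, fun h i => ⟨h.2 i, h.1 i⟩⟩
    rw [hbox, ← Measure.restrict_restrict (measurableSet_box hm.compl k),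
      ← lintegral_indicator (measurableSet_box hm.compl k)]
    refine setLIntegral_congr_fun (measurableSet_box hm' k) fun y hy => ?_
    have hdisj : ∀ {l : ℕ} {z : Fin l → Pt d}, z ∈ box Δ' l →
        Disjoint (Config.ofTuple z).1 η.1 := by
      intro l z hz
      refine Set.disjoint_left.mpr ?_
      rintro _ ⟨i, rfl⟩ hi
      exact hηout hi (hz i)
    by_cases hyΔ : y ∈ box Δᶜ k
    · have hmem : (Config.ofTuple y).union η ∈ Config.outside Δ := by
        rintro p (⟨i, rfl⟩ | hp)
        · exact hyΔ i
        · exact fun h => hηout hp (hsub h)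
      rw [Set.indicator_of_mem hmem, Set.indicator_of_mem hyΔ]
      exact boltzmann_mul_boltzmann hΛ hH hη (Config.ofTuple_finite x) (Config.ofTuple_finite y)
        (hdisj (box_mono hsub n hx)) (hdisj hy)
    · have hmem : (Config.ofTuple y).union η ∉ Config.outside Δ := fun h =>
        hyΔ fun i => h (Or.inl ⟨i, rfl⟩)
      rw [Set.indicator_of_notMem hmem, Set.indicator_of_notMem hyΔ, zero_mul]
  have hcongr : ∀ᵐ η ∂P, η ∈ Config.outside Δ' →
      (∑' k : ℕ, ENNReal.ofReal (Real.exp (k * μ) / k.factorial) *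
        ∫⁻ y in box Δ' k, (Config.outside Δ).indicator (boltzmann Λ H (Config.ofTuple x))
          ((Config.ofTuple y).union η) * boltzmann Λ H (Config.ofTuple y) η) =
      ∑' k : ℕ, weight μ k * ∫⁻ y in box (Δ' \ Δ) k,
          boltzmann Λ H ((Config.ofTuple x).union (Config.ofTuple y)) η := by
    filter_upwards [hpt] with η h hη
    exact tsum_congr fun k => by rw [h hη k, weight]
  rw [setLIntegral_congr_fun_ae hout' hcongr, lintegral_tsum fun k =>
    ((hjoint k).lintegral_prod_right'.const_mul _).aemeasurable]
  refine tsum_congr fun k => ?_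
  rw [lintegral_const_mul' _ _ (weight_ne_top μ k),
    lintegral_lintegral_swap (hjoint k).aemeasurable]
  rfl

/-- Integrating over `k` points in `Δ` and then `l` points in `Δ' \ Δ` amounts to integrating over
`k + l` points of `Δ'`. The product of the weights supplies exactly the binomial coefficient that
counts the sortings. -/
theorem grandIntegral_eq_of_subset [SFinite P] (hΛ : IsExhausting Λ) (hH : IsHamiltonian H)
    (hG : IsGibbs Λ μ H P) {Δ Δ' : Set (Pt d)} (hb : Bornology.IsBounded Δ')
    (hm : MeasurableSet Δ) (hm' : MeasurableSet Δ') (hsub : Δ ⊆ Δ') {n : ℕ} {x : Fin n → Pt d}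
    (hx : x ∈ box Δ n) :
    grandIntegral Λ μ H P Δ (Config.ofTuple x) = grandIntegral Λ μ H P Δ' (Config.ofTuple x) := by
  set φ : Config d → ℝ≥0∞ := fun ζ => outerIntegral Λ H P Δ' ((Config.ofTuple x).union ζ) with hφ
  have hφm : ∀ n, Measurable fun z : Fin n → Pt d => φ (Config.ofTuple z) := by
    intro n
    simp only [hφ, ← Config.ofTuple_append]
    exact measurable_outerIntegral hΛ hH Δ' (measurable_append measurable_const measurable_id)
  have hleft : ∀ k, ∫⁻ y in box Δ k,
      outerIntegral Λ H P Δ ((Config.ofTuple x).union (Config.ofTuple y)) =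
      ∑' l, weight μ l * ∫⁻ y in box Δ k, ∫⁻ y' in box (Δ' \ Δ) l,
        φ ((Config.ofTuple y).union (Config.ofTuple y')) := by
    intro k
    have hmeas : ∀ l, Measurable fun y : Fin k → Pt d => ∫⁻ y' in box (Δ' \ Δ) l,
        φ ((Config.ofTuple y).union (Config.ofTuple y')) := fun l =>
      (measurable_union_ofTuple hφm k l).lintegral_prod_right'
    have hswap := lintegral_tsum (μ := volume.restrict (box Δ k))
      fun l => ((hmeas l).const_mul (weight μ l)).aemeasurable
    simp only [lintegral_const_mul' _ _ (weight_ne_top μ _)] at hswap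
    rw [← hswap]
    refine setLIntegral_congr_fun (measurableSet_box hm k) fun y hy => ?_
    simp only [hφ, ← Config.union_assoc]
    rw [← Config.ofTuple_append]
    exact outerIntegral_eq_tsum hΛ hH hG hb hm hm' hsub (append_mem_box hx hy)
  simp only [grandIntegral, hleft]
  simp_rw [← ENNReal.tsum_mul_left]
  rw [tsum_tsum_eq_tsum_sum_range]
  refine tsum_congr fun N => ?_
  have := setLIntegral_box_sdiff hφm hm hm' hsub N
  simp only [hφ] at this ⊢
  rw [this, Finset.mul_sum]
  refine Finset.sum_congr rfl fun k hk => ?_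
  have hk : k + (N - k) = N := by have := Finset.mem_range.mp hk; omega
  rw [← mul_assoc, ← mul_assoc, weight_mul_weight, hk]

theorem grandIntegral_eq [SFinite P] (hΛ : IsExhausting Λ) (hH : IsHamiltonian H)
    (hG : IsGibbs Λ μ H P) {Δ Δ' : Set (Pt d)} (hb : Bornology.IsBounded Δ)
    (hb' : Bornology.IsBounded Δ') (hm : MeasurableSet Δ) (hm' : MeasurableSet Δ') {n : ℕ}
    {x : Fin n → Pt d} (hx : x ∈ box Δ n) (hx' : x ∈ box Δ' n) :
    grandIntegral Λ μ H P Δ (Config.ofTuple x) = grandIntegral Λ μ H P Δ' (Config.ofTuple x) :=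
  (grandIntegral_eq_of_subset hΛ hH hG (hb.union hb') hm (hm.union hm') Set.subset_union_left hx).trans
    (grandIntegral_eq_of_subset hΛ hH hG (hb.union hb') hm' (hm.union hm')
      Set.subset_union_right hx').symm

theorem mem_box_closedBall {n : ℕ} (x : Fin n → Pt d) {r : ℝ} (hr : ∑ i, ‖x i‖ ≤ r) :
    x ∈ box (Metric.closedBall 0 r) n := fun i => by
  rw [Metric.mem_closedBall, dist_zero_right]
  exact (Finset.single_le_sum (f := fun i => ‖x i‖) (fun i _ => norm_nonneg _)
    (Finset.mem_univ i)).trans hr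

/-- The correlation functions can be computed in any bounded Borel set containing the points. -/
theorem corr_eq [SFinite P] (hΛ : IsExhausting Λ) (hH : IsHamiltonian H)
    (hG : IsGibbs Λ μ H P) {Δ : Set (Pt d)} (hb : Bornology.IsBounded Δ) (hm : MeasurableSet Δ)
    {n : ℕ} {x : Fin n → Pt d} (hx : x ∈ box Δ n) :
    corr Λ μ H P n x =
      ENNReal.ofReal (Real.exp (n * μ)) * grandIntegral Λ μ H P Δ (Config.ofTuple x) := by
  rw [corr, corrIn_eq, grandIntegral_eq hΛ hH hG Metric.isBounded_closedBall hb
    measurableSet_closedBall hm (mem_box_closedBall x (by linarith)) hx]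

theorem measurable_grandIntegral [SFinite P] (hΛ : IsExhausting Λ) (hH : IsHamiltonian H)
    (Δ : Set (Pt d)) (n : ℕ) :
    Measurable fun x : Fin n → Pt d => grandIntegral Λ μ H P Δ (Config.ofTuple x) := by
  refine Measurable.tsum fun k => Measurable.const_mul ?_ _
  simp only [← Config.ofTuple_append]
  exact Measurable.lintegral_prod_right'
    (f := fun p : (Fin n → Pt d) × (Fin k → Pt d) =>
      outerIntegral Λ H P Δ (Config.ofTuple (Fin.append p.1 p.2)))
    (measurable_outerIntegral hΛ hH Δ (measurable_append measurable_fst measurable_snd))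

/-- The ball in the definition of `corr` moves with `x`. Volume independence replaces it by fixed
balls of growing radius, and at each `x` the resulting sequence is eventually constant. -/
theorem measurable_corr [SFinite P] (hΛ : IsExhausting Λ) (hH : IsHamiltonian H)
    (hG : IsGibbs Λ μ H P) (n : ℕ) : Measurable (corr Λ μ H P n) := by
  refine measurable_of_tendsto_metrizable (f := fun (N : ℕ) (x : Fin n → Pt d) =>
    ENNReal.ofReal (Real.exp (n * μ)) *
      grandIntegral Λ μ H P (Metric.closedBall 0 N) (Config.ofTuple x))
    (fun N => (measurable_grandIntegral hΛ hH _ n).const_mul _) ?_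
  refine tendsto_pi_nhds.mpr fun x => Tendsto.congr' ?_ tendsto_const_nhds
  obtain ⟨N₀, hN₀⟩ := exists_nat_ge (∑ i, ‖x i‖)
  filter_upwards [eventually_ge_atTop N₀] with N hN
  exact corr_eq hΛ hH hG Metric.isBounded_closedBall measurableSet_closedBall
    (mem_box_closedBall x (hN₀.trans (by exact_mod_cast hN)))

end

/-! ### Janossy densities from correlation functions -/

section

theorem tsum_eq_tsum_sum_antidiagonal {f : ℕ × ℕ → ℝ} (hf : Summable f) :
    ∑' p, f p = ∑' n, ∑ p ∈ Finset.HasAntidiagonal.antidiagonal n, f p := by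
  have hf' : Summable fun c => f (Finset.HasAntidiagonal.sigmaAntidiagonalEquivProd (A := ℕ) c) :=
    (Equiv.summable_iff Finset.HasAntidiagonal.sigmaAntidiagonalEquivProd).mpr hf
  rw [← Equiv.tsum_eq (Finset.HasAntidiagonal.sigmaAntidiagonalEquivProd (A := ℕ)) f,
    hf'.tsum_sigma' fun n => (hasSum_fintype _).summable]
  refine tsum_congr fun n => ?_
  rw [tsum_fintype, ← Finset.sum_coe_sort (Finset.HasAntidiagonal.antidiagonal n)]
  rfl

/-- Inversion of the binomial transform `R k = ∑_l (k + l choose k) J (k + l)`. -/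
theorem hasSum_binomial_inversion {J R : ℕ → ℝ≥0∞}
    (hR : ∀ k, R k = ∑' l, ((k + l).choose k : ℝ≥0∞) * J (k + l)) (hfin : ∑' k, R k ≠ ∞) :
    HasSum (fun k => (-1 : ℝ) ^ k * (R k).toReal) (J 0).toReal := by
  set g : ℕ × ℕ → ℝ≥0∞ := fun p => ((p.1 + p.2).choose p.1 : ℝ≥0∞) * J (p.1 + p.2) with hg
  have hgfin : ∑' p, g p ≠ ∞ := by
    rw [ENNReal.tsum_prod']
    simpa only [hg, ← hR] using hfin
  have hgp : ∀ p, g p ≠ ∞ := ENNReal.ne_top_of_tsum_ne_top hgfin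
  have hgs : Summable fun p => (g p).toReal := ENNReal.summable_toReal hgfin
  set f : ℕ × ℕ → ℝ := fun p => (-1 : ℝ) ^ p.1 * (g p).toReal with hf
  have hfs : Summable f := by
    refine Summable.of_norm ?_
    simpa [hf, abs_mul] using hgs
  have hfib : ∀ k, HasSum (fun l => f (k, l)) ((-1 : ℝ) ^ k * (R k).toReal) := by
    intro k
    rw [hR k]
    have hk : ∑' l, g (k, l) ≠ ∞ := by
      have := ENNReal.ne_top_of_tsum_ne_top hfin k
      rwa [hR k] at this
    rw [ENNReal.tsum_toReal_eq (ENNReal.ne_top_of_tsum_ne_top hk)]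
    exact (ENNReal.hasSum_toReal hk).mul_left _
  have hsum := hfs.hasSum.prod_fiberwise hfib
  convert hsum using 1
  -- Absolute summability permits regrouping along `k + l = n`, where the alternating sum of
  -- binomial coefficients leaves only `n = 0`.
  have hdiag : ∀ n : ℕ, ∑ p ∈ Finset.HasAntidiagonal.antidiagonal n, f p =
      if n = 0 then (J 0).toReal else 0 := by
    intro n
    have h2 : ∑ p ∈ Finset.HasAntidiagonal.antidiagonal n, f p =
        (∑ k ∈ Finset.range (n + 1), (-1 : ℝ) ^ k * (n.choose k : ℝ)) * (J n).toReal := by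
      rw [Finset.Nat.sum_antidiagonal_eq_sum_range_succ_mk, Finset.sum_mul]
      refine Finset.sum_congr rfl fun k hk => ?_
      have hk : k + (n - k) = n := by have := Finset.mem_range.mp hk; omega
      simp only [hf, hg, hk, ENNReal.toReal_mul, ENNReal.toReal_natCast]
      ring
    have h3 : (∑ k ∈ Finset.range (n + 1), (-1 : ℝ) ^ k * (n.choose k : ℝ)) =
        if n = 0 then 1 else 0 := by
      have := Int.alternating_sum_range_choose (n := n)
      exact_mod_cast congrArg (Int.cast : ℤ → ℝ) this
    rw [h2, h3]
    split_ifs with h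
    · rw [h, one_mul]
    · rw [zero_mul]
  rw [tsum_eq_tsum_sum_antidiagonal hfs]
  simp only [hdiag, tsum_ite_eq]

variable {d : ℕ} {Λ : ℕ → Set (Pt d)} {μ : ℝ} {H : Config d → EReal} {P : Measure (Config d)}

theorem lintegral_box_zero (Δ : Set (Pt d)) (f : (Fin 0 → Pt d) → ℝ≥0∞) (x : Fin 0 → Pt d) :
    ∫⁻ y in box Δ 0, f y = f x := by
  rw [volume_restrict_box, Measure.pi_of_empty (x := x), lintegral_dirac]

/-- The integrated grand integrals are the binomial transform of the sequence `J N = weight μ N *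
∫_{Δ^N}` of outer integrals, and `J 0` is the outer integral of `x` itself. -/
theorem hasSum_outerIntegral [SFinite P] (hΛ : IsExhausting Λ) (hH : IsHamiltonian H)
    {Δ : Set (Pt d)} (hm : MeasurableSet Δ) {n : ℕ} (x : Fin n → Pt d)
    (hfin : ∑' k, weight μ k * ∫⁻ y in box Δ k,
      grandIntegral Λ μ H P Δ ((Config.ofTuple x).union (Config.ofTuple y)) ≠ ∞) :
    HasSum (fun k => (-1 : ℝ) ^ k * (weight μ k * ∫⁻ y in box Δ k,
      grandIntegral Λ μ H P Δ ((Config.ofTuple x).union (Config.ofTuple y))).toReal)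
      (outerIntegral Λ H P Δ (Config.ofTuple x)).toReal := by
  set φ : Config d → ℝ≥0∞ := fun ζ => outerIntegral Λ H P Δ ((Config.ofTuple x).union ζ) with hφ
  have hφm : ∀ n, Measurable fun z : Fin n → Pt d => φ (Config.ofTuple z) := by
    intro n
    simp only [hφ, ← Config.ofTuple_append]
    exact measurable_outerIntegral hΛ hH Δ (measurable_append measurable_const measurable_id)
  have h := hasSum_binomial_inversion
    (J := fun N => weight μ N * ∫⁻ z in box Δ N, φ (Config.ofTuple z)) (fun k => ?_) hfin
  · convert h using 2
    rw [lintegral_box_zero Δ _ Fin.elim0]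
    simp [weight, hφ, Config.union_ofTuple_zero]
  · have hmeas : ∀ l, Measurable fun y : Fin k → Pt d => ∫⁻ y' in box Δ l,
        φ ((Config.ofTuple y).union (Config.ofTuple y')) := fun l =>
      (measurable_union_ofTuple hφm k l).lintegral_prod_right'
    have hswap := lintegral_tsum (μ := volume.restrict (box Δ k))
      fun l => ((hmeas l).const_mul (weight μ l)).aemeasurable
    simp only [lintegral_const_mul' _ _ (weight_ne_top μ _)] at hswap
    simp only [grandIntegral, Config.union_assoc]
    refine (congrArg (weight μ k * ·) hswap).trans ?_
    rw [← ENNReal.tsum_mul_left]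
    refine tsum_congr fun l => ?_
    rw [setLIntegral_box_add hφm k l hm, ← mul_assoc, ← mul_assoc, weight_mul_weight,
      mul_comm (weight μ (k + l))]

/-- This gives symmetry of the correlation functions and disposes of casts between `Fin (1 + n)` and
`Fin (n + 1)`. The equality of lengths is a separate hypothesis because `Config.ofTuple` forgets
multiplicities. -/
theorem corr_congr [SFinite P] (hΛ : IsExhausting Λ) (hH : IsHamiltonian H)
    (hG : IsGibbs Λ μ H P) {m n : ℕ} (h : m = n) {x : Fin m → Pt d} {y : Fin n → Pt d}
    (hxy : Config.ofTuple x = Config.ofTuple y) : corr Λ μ H P m x = corr Λ μ H P n y := by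
  subst h
  have hb := Metric.isBounded_closedBall (x := (0 : Pt d)) (r := (∑ i, ‖x i‖) + ∑ i, ‖y i‖)
  have hx := mem_box_closedBall x (r := (∑ i, ‖x i‖) + ∑ i, ‖y i‖)
    (le_add_of_nonneg_right (Finset.sum_nonneg fun _ _ => norm_nonneg _))
  have hy := mem_box_closedBall y (r := (∑ i, ‖x i‖) + ∑ i, ‖y i‖)
    (le_add_of_nonneg_left (Finset.sum_nonneg fun _ _ => norm_nonneg _))
  rw [corr_eq hΛ hH hG hb measurableSet_closedBall hx,
    corr_eq hΛ hH hG hb measurableSet_closedBall hy, hxy]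

/-- This is the Ruelle equation for `G = 1`, that is, the normalisation of `P`. It supplies the
value at `n = 0` on which the cluster recursion depends. -/
theorem corr_zero [IsProbabilityMeasure P] (hΛ : IsExhausting Λ) (hH : IsHamiltonian H)
    (hG : IsGibbs Λ μ H P) (x : Fin 0 → Pt d) : corr Λ μ H P 0 x = 1 := by
  have hb := Metric.isBounded_closedBall (x := (0 : Pt d)) (r := 0)
  rw [corr_eq hΛ hH hG hb measurableSet_closedBall (fun i => i.elim0)]
  have h := hG.ruelle_equation _ hb measurableSet_closedBall (fun _ => 1) measurable_const
  simp only [lintegral_one, measure_univ, one_mul] at h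
  have hjoint : ∀ k, Measurable fun p : Config d × (Fin k → Pt d) =>
      boltzmann Λ H (Config.ofTuple p.2) p.1 := fun k =>
    measurable_boltzmann hΛ hH.measurable measurable_snd measurable_fst
  rw [h, lintegral_tsum fun k => ((hjoint k).lintegral_prod_right'.const_mul _).aemeasurable]
  simp only [Nat.cast_zero, zero_mul, Real.exp_zero, ENNReal.ofReal_one, one_mul, grandIntegral,
    Config.ofTuple_zero_union]
  refine tsum_congr fun k => ?_
  rw [lintegral_const_mul' _ _ ENNReal.ofReal_ne_top,
    lintegral_lintegral_swap (hjoint k).aemeasurable, weight]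
  rfl

/-- The Janossy densities in terms of the correlation functions. -/
theorem hasSum_janossy [IsProbabilityMeasure P] (hΛ : IsExhausting Λ) (hH : IsHamiltonian H)
    (hG : IsGibbs Λ μ H P) (hR : RuelleCondition Λ μ H P) {Δ : Set (Pt d)}
    (hb : Bornology.IsBounded Δ) (hm : MeasurableSet Δ) {n : ℕ} {x : Fin n → Pt d}
    (hx : x ∈ box Δ n) :
    HasSum (fun k : ℕ => (-1 : ℝ) ^ k / k.factorial *
      ∫ y in box Δ k, (corr Λ μ H P (n + k) (Fin.append x y)).toReal)
      (janossy Λ μ H P Δ n x).toReal := by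
  obtain ⟨ξ, hξ, hbound⟩ := hR
  have hbound' : ∀ (m : ℕ) (z : Fin m → Pt d), corr Λ μ H P m z ≤ ENNReal.ofReal (ξ ^ m) := by
    intro m z
    rcases Nat.eq_zero_or_pos m with rfl | hm
    · simp [corr_zero hΛ hH hG]
    · exact hbound m hm z
  have hterm : ∀ k : ℕ, ENNReal.ofReal (Real.exp (n * μ)) * (weight μ k * ∫⁻ y in box Δ k,
      grandIntegral Λ μ H P Δ ((Config.ofTuple x).union (Config.ofTuple y))) =
      ((k.factorial : ℕ) : ℝ≥0∞)⁻¹ *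
        ∫⁻ y in box Δ k, corr Λ μ H P (n + k) (Fin.append x y) := by
    intro k
    have : ∫⁻ y in box Δ k, corr Λ μ H P (n + k) (Fin.append x y) =
        ∫⁻ y in box Δ k, ENNReal.ofReal (Real.exp ((n + k : ℕ) * μ)) *
          grandIntegral Λ μ H P Δ ((Config.ofTuple x).union (Config.ofTuple y)) :=
      setLIntegral_congr_fun (measurableSet_box hm k) fun y hy => by
        rw [corr_eq hΛ hH hG hb hm (append_mem_box hx hy), Config.ofTuple_append]
    rw [this, lintegral_const_mul' _ _ ENNReal.ofReal_ne_top, weight_eq, Nat.cast_add, add_mul,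
      Real.exp_add, ENNReal.ofReal_mul (by positivity)]
    ring
  -- The Ruelle bound yields an exponential series in `ξ |Δ|`, so the inversion converges absolutely
  -- in every bounded volume.
  have hle : ∀ k : ℕ, ((k.factorial : ℕ) : ℝ≥0∞)⁻¹ *
      ∫⁻ y in box Δ k, corr Λ μ H P (n + k) (Fin.append x y) ≤
        ENNReal.ofReal (ξ ^ n * ((ξ * (volume Δ).toReal) ^ k / k.factorial)) := by
    intro k
    have hV : volume (box Δ k) = ENNReal.ofReal ((volume Δ).toReal ^ k) := by
      rw [box_eq_pi, volume_pi, Measure.pi_pi, Finset.prod_const, Finset.card_univ,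
        Fintype.card_fin, ENNReal.ofReal_pow ENNReal.toReal_nonneg,
        ENNReal.ofReal_toReal hb.measure_lt_top.ne]
    calc _ ≤ ((k.factorial : ℕ) : ℝ≥0∞)⁻¹ * ∫⁻ _ in box Δ k, ENNReal.ofReal (ξ ^ (n + k)) := by
          gcongr; exact hbound' _ _
      _ = _ := by
          rw [setLIntegral_const, hV, ← ENNReal.ofReal_mul (by positivity), ← ENNReal.ofReal_natCast,
            ← ENNReal.ofReal_inv_of_pos (by positivity), ← ENNReal.ofReal_mul (by positivity)]
          congr 1
          rw [mul_pow]; ring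
  have hsum : ∑' k : ℕ, ((k.factorial : ℕ) : ℝ≥0∞)⁻¹ *
      ∫⁻ y in box Δ k, corr Λ μ H P (n + k) (Fin.append x y) ≠ ∞ :=
    ne_top_of_le_ne_top
      (((Real.summable_pow_div_factorial _).mul_left _).tsum_ofReal_ne_top) (ENNReal.tsum_le_tsum hle)
  have hfin : ∑' k, weight μ k * ∫⁻ y in box Δ k,
      grandIntegral Λ μ H P Δ ((Config.ofTuple x).union (Config.ofTuple y)) ≠ ∞ := by
    simp only [← hterm, ENNReal.tsum_mul_left] at hsum
    refine fun h => hsum ?_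
    rw [h, ENNReal.mul_top]
    simpa using Real.exp_pos _
  have h := (hasSum_outerIntegral hΛ hH hm x hfin).mul_left (Real.exp (n * μ))
  rw [janossy_eq, ENNReal.toReal_mul, ENNReal.toReal_ofReal (Real.exp_pos _).le]
  refine Eq.mp (congrArg (fun f : ℕ → ℝ => HasSum f _) (funext fun k => ?_)) h
  symm
  have hk := congrArg ENNReal.toReal (hterm k)
  rw [ENNReal.toReal_mul, ENNReal.toReal_ofReal (Real.exp_pos _).le,
    ENNReal.toReal_mul (a := (_ : ℝ≥0∞)⁻¹), ENNReal.toReal_inv, ENNReal.toReal_natCast] at hk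
  rw [integral_toReal, mul_left_comm, hk]
  · ring
  · exact ((measurable_corr hΛ hH hG _).comp
      (measurable_append measurable_const measurable_id)).aemeasurable
  · exact Eventually.of_forall fun y => (hbound' _ _).trans_lt ENNReal.ofReal_lt_top

/-- The value of `H` on the empty configuration is not prescribed. The Ruelle equation in the empty
volume, where only the `n = 0` term survives, shows that the Boltzmann factor of no particles
integrates like `1` over `Γ_{Δᶜ}`. -/
theorem janossy_zero (hG : IsGibbs Λ μ H P) {Δ : Set (Pt d)} (hb : Bornology.IsBounded Δ) (hm : MeasurableSet Δ)
    (x : Fin 0 → Pt d) : janossy Λ μ H P Δ 0 x = P (Config.outside Δ) := by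
  have hout := Config.measurableSet_outside hb hm
  have h := hG.ruelle_equation ∅ Bornology.isBounded_empty MeasurableSet.empty
    ((Config.outside Δ).indicator 1) (measurable_one.indicator hout)
  rw [lintegral_indicator_one hout] at h
  rw [h, janossy_eq, outerIntegral, ← lintegral_indicator hout]
  have huniv : Config.outside (∅ : Set (Pt d)) = Set.univ := by
    ext η; simp [Config.outside]
  rw [huniv, Measure.restrict_univ]
  simp only [Nat.cast_zero, zero_mul, Real.exp_zero, ENNReal.ofReal_one, one_mul]
  refine lintegral_congr fun η => ?_
  rw [tsum_eq_single 0, lintegral_box_zero ∅ _ x, Config.ofTuple_zero_union]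
  · by_cases hη : η ∈ Config.outside Δ <;> simp [hη]
  · intro k hk
    have : box (∅ : Set (Pt d)) k = ∅ :=
      Set.eq_empty_iff_forall_notMem.mpr fun y hy => hy ⟨0, Nat.pos_of_ne_zero hk⟩
    rw [this, Measure.restrict_empty, lintegral_zero_measure, mul_zero]

theorem janossy_one (hH : IsHamiltonian H) {Δ : Set (Pt d)} (x : Fin 1 → Pt d) :
    janossy Λ μ H P Δ 1 x = ENNReal.ofReal (Real.exp μ) *
      ∫⁻ η in Config.outside Δ, EReal.exp (-interaction Λ H (Config.single (x 0)) η) ∂P := by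
  have h1 : Config.ofTuple x = Config.single (x 0) := by
    rw [Config.ofTuple_succ, Config.union_ofTuple_zero]
  rw [janossy_eq, outerIntegral, h1]
  simp only [boltzmann, hH.no_self_interaction, zero_add, Nat.cast_one, one_mul]

end

/-! ### Set partitions and the cluster recursion -/

section

section Partitions

/-- The sum over all partitions of `s` of the products of the weights of the blocks. -/
def partitionSum {α : Type*} [DecidableEq α] (t : Finset α → ℝ) (s : Finset α) : ℝ :=
  ∑ π : Finpartition s, ∏ b ∈ π.parts, t b

theorem partitionSum_empty {α : Type*} [DecidableEq α] (t : Finset α → ℝ) :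
    partitionSum t ∅ = 1 := by
  have h : ∀ π : Finpartition (∅ : Finset α), ∏ b ∈ π.parts, t b = 1 := fun π => by
    rw [π.parts_eq_empty_iff.mpr rfl, Finset.prod_empty]
  rw [partitionSum, Finset.sum_congr rfl fun π _ => h π]
  have : Fintype.card (Finpartition (∅ : Finset α)) = 1 :=
    Fintype.card_eq_one_iff.mpr ⟨Finpartition.empty _, fun π => Finpartition.ext
      ((π.parts_eq_empty_iff.mpr rfl).trans rfl)⟩
  simp [this]

/-- A partition of `s` is the block `b` containing `a` together with an arbitrary partition of `s \
b`. -/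
theorem partitionSum_eq_sum_block {α : Type*} [DecidableEq α] (t : Finset α → ℝ) {s : Finset α}
    {a : α} (ha : a ∈ s) :
    partitionSum t s = ∑ b ∈ s.powerset with a ∈ b, t b * partitionSum t (s \ b) := by
  simp only [partitionSum, Finset.mul_sum]
  rw [Finset.sum_sigma']
  symm
  have key : ∀ p ∈ (s.powerset.filter (a ∈ ·)).sigma
      (fun b => (Finset.univ : Finset (Finpartition (s \ b)))), a ∈ p.1 ∧ p.1 ⊆ s := by
    intro p hp
    have := (Finset.mem_sigma.mp hp).1
    rw [Finset.mem_filter, Finset.mem_powerset] at this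
    exact ⟨this.2, this.1⟩
  have hnot : ∀ (b : Finset α), a ∈ b → ∀ π : Finpartition (s \ b), ∀ c ∈ π.parts, a ∉ c :=
    fun b hb π c hc hac => (Finset.mem_sdiff.mp (π.subset hc hac)).2 hb
  refine Finset.sum_bij (fun p hp => p.2.extend (c := s)
    (Finset.nonempty_iff_ne_empty.mp ⟨a, (key p hp).1⟩) Finset.sdiff_disjoint
    (Finset.sdiff_union_of_subset (key p hp).2)) (fun _ _ => Finset.mem_univ _) ?_ ?_ ?_
  · rintro ⟨b, π⟩ hp ⟨b', π'⟩ hp' h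
    have hab := (key _ hp).1
    have hab' := (key _ hp').1
    have hparts : insert b π.parts = insert b' π'.parts := congrArg Finpartition.parts h
    have hbb : b = b' := by
      have : b ∈ insert b' π'.parts := hparts ▸ Finset.mem_insert_self _ _
      rcases Finset.mem_insert.mp this with h | h
      · exact h
      · exact absurd hab (hnot b' hab' π' b h)
    subst hbb
    have hb1 : b ∉ π.parts := fun h => hnot b hab π b h hab
    have hb2 : b ∉ π'.parts := fun h => hnot b hab π' b h hab
    have : π = π' := Finpartition.ext (by
      rw [← Finset.erase_insert hb1, ← Finset.erase_insert hb2, hparts])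
    rw [this]
  · intro π _
    have hmem : π.part a ∈ π.parts := (π.part_mem).mpr ha
    have hself : a ∈ π.part a := (π.mem_part_self).mpr ha
    let π' : Finpartition (s \ π.part a) := Finpartition.ofExistsUnique (π.parts.erase (π.part a))
      (fun p hp => by
        rw [Finset.mem_erase] at hp
        intro i hi
        rw [Finset.mem_sdiff]
        exact ⟨π.subset hp.2 hi, fun hi' => hp.1 (π.eq_of_mem_parts hp.2 hmem hi hi')⟩)
      (fun i hi => by
        rw [Finset.mem_sdiff] at hi
        obtain ⟨c, hc, hic⟩ := π.exists_mem hi.1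
        refine ⟨c, ⟨Finset.mem_erase.mpr ⟨fun h => hi.2 (h ▸ hic), hc⟩, hic⟩, ?_⟩
        rintro c' ⟨hc', hic'⟩
        exact π.eq_of_mem_parts (Finset.mem_erase.mp hc').2 hc hic' hic)
      (fun h => π.empty_notMem_parts (Finset.mem_erase.mp h).2)
    refine ⟨⟨π.part a, π'⟩, Finset.mem_sigma.mpr ⟨?_, Finset.mem_univ _⟩, ?_⟩
    · rw [Finset.mem_filter, Finset.mem_powerset]
      exact ⟨π.part_subset a, hself⟩
    · exact Finpartition.ext (Finset.insert_erase hmem)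
  · rintro ⟨b, π⟩ hp
    have hab := (key _ hp).1
    rw [Finpartition.extend_parts, Finset.prod_insert fun h => hnot b hab π b h hab]

/-- Invariance under relabelling, needed because `truncate` works on `Fin s.card` while the blocks
are subsets `s` of a larger index set. -/
theorem partitionSum_map {α β : Type*} [DecidableEq α] [DecidableEq β] (e : α ↪ β)
    (t : Finset β → ℝ) (s : Finset α) :
    partitionSum t (s.map e) = partitionSum (fun b => t (b.map e)) s := by
  symm
  let j : Finpartition s → Finpartition (s.map e) := fun π =>
    Finpartition.ofExistsUnique (π.parts.map (Finset.mapEmbedding e).toEmbedding)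
      (fun p hp => by
        obtain ⟨b, hb, rfl⟩ := Finset.mem_map.mp hp
        exact Finset.map_subset_map.mpr (π.subset hb))
      (fun i hi => by
        obtain ⟨k, hk, rfl⟩ := Finset.mem_map.mp hi
        obtain ⟨c, hc, hkc⟩ := π.exists_mem hk
        refine ⟨c.map e, ⟨Finset.mem_map_of_mem _ hc, Finset.mem_map_of_mem _ hkc⟩, ?_⟩
        rintro c' ⟨hc', hkc'⟩
        obtain ⟨b, hb, rfl⟩ := Finset.mem_map.mp hc'
        have : k ∈ b := (Finset.mem_map' e).mp hkc'
        rw [π.eq_of_mem_parts hb hc this hkc]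
        rfl)
      (fun h => by
        obtain ⟨b, hb, hbe⟩ := Finset.mem_map.mp h
        have : b = ∅ := Finset.map_eq_empty.mp hbe
        exact π.empty_notMem_parts (this ▸ hb))
  refine Finset.sum_bij (fun π _ => j π) (fun _ _ => Finset.mem_univ _) ?_ ?_ ?_
  · intro π _ π' _ h
    exact Finpartition.ext (Finset.map_injective _ (congrArg Finpartition.parts h))
  · intro π _
    have hpre : ∀ b ∈ π.parts, (b.preimage e e.injective.injOn).map e = b := by
      intro b hb
      ext i
      simp only [Finset.mem_map, Finset.mem_preimage]
      constructor
      · rintro ⟨k, hk, rfl⟩; exact hk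
      · intro hi
        obtain ⟨k, -, rfl⟩ := Finset.mem_map.mp (π.subset hb hi)
        exact ⟨k, hi, rfl⟩
    let π' : Finpartition s := Finpartition.ofExistsUnique
      (π.parts.image fun b => b.preimage e e.injective.injOn)
      (fun p hp => by
        obtain ⟨b, hb, rfl⟩ := Finset.mem_image.mp hp
        exact Finset.map_subset_map.mp ((hpre b hb).symm ▸ π.subset hb))
      (fun i hi => by
        obtain ⟨c, hc, hic⟩ := π.exists_mem (Finset.mem_map_of_mem e hi)
        refine ⟨_, ⟨Finset.mem_image_of_mem _ hc, Finset.mem_preimage.mpr hic⟩, ?_⟩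
        rintro c' ⟨hc', hic'⟩
        obtain ⟨b, hb, rfl⟩ := Finset.mem_image.mp hc'
        rw [π.eq_of_mem_parts hb hc (Finset.mem_preimage.mp hic') hic])
      (fun h => by
        obtain ⟨b, hb, hbe⟩ := Finset.mem_image.mp h
        have := hpre b hb
        rw [hbe, Finset.map_empty] at this
        exact π.empty_notMem_parts (this ▸ hb))
    refine ⟨π', Finset.mem_univ _, Finpartition.ext ?_⟩
    change (π.parts.image fun b => b.preimage e e.injective.injOn).map
      (Finset.mapEmbedding e).toEmbedding = π.parts
    rw [Finset.map_eq_image, Finset.image_image]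
    exact (Finset.image_congr fun b hb => hpre b hb).trans Finset.image_id
  · intro π _
    exact (Finset.prod_map π.parts (Finset.mapEmbedding e).toEmbedding t).symm

end Partitions

section Truncate

variable {X : Type}

/-- The subtuple of `x` indexed by `s`. -/
def subtuple {n : ℕ} (x : Fin n → X) (s : Finset (Fin n)) : Fin s.card → X :=
  fun i => x (s.orderEmbOfFin rfl i)

theorem family_congr (F : ∀ n : ℕ, (Fin n → X) → ℝ) {m n : ℕ} (h : m = n) {x : Fin m → X}
    {y : Fin n → X} (hxy : ∀ i, x i = y (Fin.cast h i)) : F m x = F n y := by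
  subst h
  congr 1
  funext i
  exact hxy i

/-- An increasing map into a finite set of the same size is its increasing enumeration. Subtuples
always keep their order, so the combinatorics never needs `F` to be symmetric. -/
theorem family_subtuple_eq (F : ∀ n : ℕ, (Fin n → X) → ℝ) {m n : ℕ} (x : Fin n → X)
    {s : Finset (Fin n)} (h : s.card = m) {f : Fin m → Fin n} (hf : StrictMono f)
    (hmem : ∀ i, f i ∈ s) : F s.card (subtuple x s) = F m fun i => x (f i) := by
  subst h
  rw [Finset.orderEmbOfFin_unique rfl hmem hf]
  rfl

theorem family_subtuple_subtuple (F : ∀ n : ℕ, (Fin n → X) → ℝ) {n : ℕ} (x : Fin n → X)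
    (s : Finset (Fin n)) (b : Finset (Fin s.card)) :
    F (b.map (s.orderEmbOfFin rfl).toEmbedding).card
      (subtuple x (b.map (s.orderEmbOfFin rfl).toEmbedding)) =
      F b.card (subtuple (subtuple x s) b) :=
  family_subtuple_eq F x (Finset.card_map _)
    (f := fun i => s.orderEmbOfFin rfl (b.orderEmbOfFin rfl i))
    ((s.orderEmbOfFin rfl).strictMono.comp (b.orderEmbOfFin rfl).strictMono)
    fun i => Finset.mem_map_of_mem _ (b.orderEmbOfFin_mem rfl i)

theorem truncate_eq (F : ∀ n : ℕ, (Fin n → X) → ℝ) (n : ℕ) (x : Fin n → X) :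
    truncate F n x = F n x -
      ∑ π : Finpartition (Finset.univ : Finset (Fin n)) with 2 ≤ π.parts.card,
        ∏ b ∈ π.parts, truncate F b.card (subtuple x b) := by
  rw [truncate, Finset.sum_subtype (Finset.univ.filter
    fun π : Finpartition (Finset.univ : Finset (Fin n)) => 2 ≤ π.parts.card)
    (p := fun π => 2 ≤ π.parts.card) (fun π => by simp)
    (fun π => ∏ b ∈ π.parts, truncate F b.card (subtuple x b))]
  congr 1
  exact Finset.sum_congr rfl fun π _ =>
    (Finset.prod_coe_sort π.1.parts fun b => truncate F b.card (subtuple x b))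

/-- For `n ≥ 1` this is the defining recursion solved for `F`, the one-block partition contributing
the truncated function. For `n = 0` the only partition has no blocks, which is where `F 0 = 1` is
needed. -/
theorem eq_partitionSum_univ {F : ∀ n : ℕ, (Fin n → X) → ℝ} (hF : ∀ x, F 0 x = 1) (n : ℕ)
    (x : Fin n → X) :
    F n x = partitionSum (fun b => truncate F b.card (subtuple x b)) Finset.univ := by
  rcases n with _ | n
  · rw [hF]
    exact (partitionSum_empty _).symm
  have hne : (Finset.univ : Finset (Fin (n + 1))) ≠ ⊥ := Finset.univ_nonempty.ne_empty
  have hone : ∑ π : Finpartition (Finset.univ : Finset (Fin (n + 1))) with ¬ 2 ≤ π.parts.card,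
      ∏ b ∈ π.parts, truncate F b.card (subtuple x b) = truncate F (n + 1) x := by
    rw [Finset.sum_eq_single_of_mem (Finpartition.indiscrete hne)]
    · rw [Finpartition.indiscrete_parts, Finset.prod_singleton]
      exact family_subtuple_eq (truncate F) x (f := id) (by simp) strictMono_id (by simp)
    · simp
    · intro π hπ hπne
      refine absurd (Finpartition.ext ?_) hπne
      rw [Finset.mem_filter] at hπ
      have hpos := Finset.card_pos.mpr (π.parts_nonempty hne)
      obtain ⟨b, hb⟩ := Finset.card_eq_one.mp (show π.parts.card = 1 by omega)
      have := π.sup_parts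
      rw [hb, Finset.sup_singleton] at this
      rw [hb, Finpartition.indiscrete_parts, ← this]
      rfl
  rw [partitionSum, ← Finset.sum_filter_add_sum_filter_not _ (fun π => 2 ≤ π.parts.card), hone,
    truncate_eq]
  ring

theorem family_subtuple_eq_partitionSum {F : ∀ n : ℕ, (Fin n → X) → ℝ} (hF : ∀ x, F 0 x = 1)
    {n : ℕ} (x : Fin n → X) (s : Finset (Fin n)) :
    F s.card (subtuple x s) =
      partitionSum (fun b => truncate F b.card (subtuple x b)) s := by
  have hs : (Finset.univ : Finset (Fin s.card)).map (s.orderEmbOfFin rfl).toEmbedding = s := by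
    ext i
    simp
  conv_rhs => rw [← hs, partitionSum_map]
  rw [eq_partitionSum_univ hF]
  congr 1
  funext b
  rw [family_subtuple_subtuple (truncate F)]

/-- The cluster recursion: the truncated functions decompose `F` according to the block that
contains the first index. -/
theorem eq_sum_truncate_mul {F : ∀ n : ℕ, (Fin n → X) → ℝ} (hF : ∀ x, F 0 x = 1) {n : ℕ}
    (x : Fin (n + 1) → X) :
    F (n + 1) x = ∑ b : Finset (Fin (n + 1)) with 0 ∈ b,
      truncate F b.card (subtuple x b) * F bᶜ.card (subtuple x bᶜ) := by
  rw [eq_partitionSum_univ hF, partitionSum_eq_sum_block _ (Finset.mem_univ (0 : Fin (n + 1))),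
    Finset.powerset_univ]
  refine Finset.sum_congr rfl fun b _ => ?_
  rw [← Finset.compl_eq_univ_sdiff, family_subtuple_eq_partitionSum hF]

theorem sum_finset_zero_mem {M : Type*} [AddCommMonoid M] {n : ℕ} (h : Finset (Fin (n + 1)) → M) :
    ∑ b : Finset (Fin (n + 1)) with 0 ∈ b, h b =
      ∑ s : Finset (Fin n), h (insert 0 (s.map (Fin.succEmb n))) := by
  symm
  have h0 : ∀ s : Finset (Fin n), (0 : Fin (n + 1)) ∉ s.map (Fin.succEmb n) := by
    intro s hs
    obtain ⟨i, -, hi⟩ := Finset.mem_map.mp hs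
    exact Fin.succ_ne_zero i hi
  refine Finset.sum_bij (fun s _ => insert 0 (s.map (Fin.succEmb n))) ?_ ?_ ?_ fun _ _ => rfl
  · intro s _
    simp
  · intro s _ s' _ hss
    have := congrArg (fun b : Finset (Fin (n + 1)) => b.erase 0) hss
    simp only [Finset.erase_insert (h0 _)] at this
    exact Finset.map_injective _ this
  · intro b hb
    refine ⟨Finset.univ.filter fun i => i.succ ∈ b, Finset.mem_univ _, ?_⟩
    have hb0 : (0 : Fin (n + 1)) ∈ b := (Finset.mem_filter.mp hb).2
    ext i
    refine Fin.cases ?_ (fun i => ?_) i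
    · simp [hb0]
    · simp [Fin.succ_ne_zero]

theorem card_insert_zero_map_succ {n : ℕ} (s : Finset (Fin n)) :
    (insert 0 (s.map (Fin.succEmb n))).card = s.card + 1 := by
  rw [Finset.card_insert_of_notMem, Finset.card_map]
  intro hs
  obtain ⟨i, -, hi⟩ := Finset.mem_map.mp hs
  exact Fin.succ_ne_zero i hi

theorem compl_insert_zero_map_succ {n : ℕ} (s : Finset (Fin n)) :
    (insert 0 (s.map (Fin.succEmb n)))ᶜ = sᶜ.map (Fin.succEmb n) := by
  ext i
  refine Fin.cases ?_ (fun i => ?_) i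
  · simp [Fin.succ_ne_zero]
  · simp [Fin.succ_ne_zero]

/-- The cluster recursion with the first argument separated. -/
theorem cons_eq_sum_truncate_mul {F : ∀ n : ℕ, (Fin n → X) → ℝ} (hF : ∀ x, F 0 x = 1) {n : ℕ}
    (a : X) (y : Fin n → X) :
    F (n + 1) (Fin.cons a y) = ∑ s : Finset (Fin n),
      truncate F (s.card + 1) (Fin.cons a (subtuple y s)) * F sᶜ.card (subtuple y sᶜ) := by
  rw [eq_sum_truncate_mul hF, sum_finset_zero_mem]
  refine Finset.sum_congr rfl fun s _ => ?_
  congr 1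
  · rw [family_subtuple_eq (truncate F) (Fin.cons a y : Fin (n + 1) → X)
      (f := Fin.cons 0 fun i => (s.orderEmbOfFin rfl i).succ) (card_insert_zero_map_succ s)]
    · congr 1
      funext i
      refine Fin.cases ?_ (fun i => ?_) i
      · simp
      · simp [subtuple]
    · intro i j hij
      induction j using Fin.cases with
      | zero => exact absurd hij (Fin.not_lt_zero i)
      | succ j =>
        induction i using Fin.cases with
        | zero => simp
        | succ i => simpa using hij
    · intro i
      induction i using Fin.cases with
      | zero => simp
      | succ i => simp [Fin.succ_ne_zero]
  · rw [compl_insert_zero_map_succ]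
    exact family_subtuple_eq F (Fin.cons a y : Fin (n + 1) → X)
      (f := fun i => (sᶜ.orderEmbOfFin rfl i).succ) (Finset.card_map _)
      ((Fin.strictMono_succ).comp (sᶜ.orderEmbOfFin rfl).strictMono)
      (fun i => by
        have := sᶜ.orderEmbOfFin_mem rfl i
        simp only [Finset.mem_map]
        exact ⟨_, this, rfl⟩)

theorem measurable_truncate [MeasurableSpace X] {F : ∀ n : ℕ, (Fin n → X) → ℝ}
    (hF : ∀ n, Measurable (F n)) (n : ℕ) : Measurable (truncate F n) := by
  induction n using Nat.strong_induction_on with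
  | _ n ih =>
    rw [funext (truncate_eq F n)]
    refine (hF n).sub (Finset.measurable_sum _ fun π hπ => Finset.measurable_prod _ fun b hb => ?_)
    refine (ih b.card (card_lt_of_mem_parts π (Finset.mem_filter.mp hπ).2 hb)).comp ?_
    exact measurable_pi_lambda _ fun i => measurable_pi_apply _

end Truncate

end

/-! ### Integrated cluster recursion and bounds on truncations -/

section

theorem sum_finset_card_compl_card {R : Type*} [CommSemiring R] (n : ℕ) (φ : ℕ → ℕ → R) :
    ∑ s : Finset (Fin n), φ s.card sᶜ.card =
      ∑ j ∈ Finset.range (n + 1), (n.choose j : R) * φ j (n - j) := by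
  have h := Finset.sum_powerset_apply_card (x := (Finset.univ : Finset (Fin n)))
    fun k => φ k (n - k)
  rw [Finset.powerset_univ, Finset.card_univ, Fintype.card_fin] at h
  simpa only [Finset.card_compl, Fintype.card_fin, nsmul_eq_mul] using h

theorem sum_finset_zero_mem_card {R : Type*} [CommSemiring R] (n : ℕ) (φ : ℕ → ℕ → R) :
    ∑ b : Finset (Fin (n + 1)) with 0 ∈ b, φ b.card bᶜ.card =
      ∑ j ∈ Finset.range (n + 1), (n.choose j : R) * φ (j + 1) (n - j) := by
  rw [← sum_finset_card_compl_card n fun j l => φ (j + 1) l,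
    sum_finset_zero_mem fun b => φ b.card bᶜ.card]
  refine Finset.sum_congr rfl fun s _ => ?_
  rw [card_insert_zero_map_succ, compl_insert_zero_map_succ, Finset.card_map]

section IntegralRecursion

variable {X : Type} [MeasurableSpace X] (ν : Measure X) [SigmaFinite ν]
  {F : ∀ n : ℕ, (Fin n → X) → ℝ}

theorem integral_subtuple_mul {n : ℕ} (s : Finset (Fin n)) (f : (Fin s.card → X) → ℝ)
    (g : (Fin sᶜ.card → X) → ℝ) :
    ∫ z, f (subtuple z s) * g (subtuple z sᶜ) ∂Measure.pi (fun _ => ν) =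
      (∫ y, f y ∂Measure.pi fun _ => ν) * ∫ y, g y ∂Measure.pi fun _ => ν :=
  integral_split_mul ν (finSumEquivOfFinset (s := s) rfl rfl) f g

theorem integrable_subtuple_mul {n : ℕ} (s : Finset (Fin n)) {f : (Fin s.card → X) → ℝ}
    {g : (Fin sᶜ.card → X) → ℝ} (hf : Integrable f (Measure.pi fun _ => ν))
    (hg : Integrable g (Measure.pi fun _ => ν)) :
    Integrable (fun z => f (subtuple z s) * g (subtuple z sᶜ)) (Measure.pi fun _ => ν) :=
  integrable_split_mul ν (finSumEquivOfFinset (s := s) rfl rfl) hf hg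

theorem lintegral_subtuple_mul {n : ℕ} (s : Finset (Fin n)) {f : (Fin s.card → X) → ℝ≥0∞}
    {g : (Fin sᶜ.card → X) → ℝ≥0∞} (hf : Measurable f) (hg : Measurable g) :
    ∫⁻ z, f (subtuple z s) * g (subtuple z sᶜ) ∂Measure.pi (fun _ => ν) =
      (∫⁻ y, f y ∂Measure.pi fun _ => ν) * ∫⁻ y, g y ∂Measure.pi fun _ => ν :=
  lintegral_split_mul ν (finSumEquivOfFinset (s := s) rfl rfl) hf hg

/-- The two factors of each cluster term involve complementary variables, so its integral factorises
and depends only on the size of the cluster. -/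
theorem integral_cons_eq_sum (hF : ∀ x, F 0 x = 1) (a : X)
    (hi : ∀ n, Integrable (F n) (Measure.pi fun _ => ν))
    (ht : ∀ n, Integrable (fun y : Fin n → X => truncate F (n + 1) (Fin.cons a y))
      (Measure.pi fun _ => ν)) (n : ℕ) :
    ∫ y, F (n + 1) (Fin.cons a y) ∂Measure.pi (fun _ => ν) =
      ∑ j ∈ Finset.range (n + 1), (n.choose j : ℝ) *
        ((∫ y : Fin j → X, truncate F (j + 1) (Fin.cons a y) ∂Measure.pi fun _ => ν) *
          ∫ y, F (n - j) y ∂Measure.pi fun _ => ν) := by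
  simp only [cons_eq_sum_truncate_mul hF]
  rw [integral_finsetSum _ fun s _ => integrable_subtuple_mul ν s (ht s.card) (hi sᶜ.card),
    ← sum_finset_card_compl_card n fun j l =>
      (∫ y : Fin j → X, truncate F (j + 1) (Fin.cons a y) ∂Measure.pi fun _ => ν) *
          ∫ y, F l y ∂Measure.pi fun _ => ν]
  exact Finset.sum_congr rfl fun s _ => integral_subtuple_mul ν s
    (fun y => truncate F (s.card + 1) (Fin.cons a y)) (F sᶜ.card)

theorem integral_eq_sum (hF : ∀ x, F 0 x = 1) (hi : ∀ n, Integrable (F n) (Measure.pi fun _ => ν))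
    (ht : ∀ n, Integrable (truncate F (n + 1)) (Measure.pi fun _ => ν)) (n : ℕ) :
    ∫ z, F (n + 1) z ∂Measure.pi (fun _ => ν) =
      ∑ j ∈ Finset.range (n + 1), (n.choose j : ℝ) *
        ((∫ y, truncate F (j + 1) y ∂Measure.pi fun _ => ν) *
          ∫ y, F (n - j) y ∂Measure.pi fun _ => ν) := by
  -- Truncations are assumed integrable only for positive size; a block containing `0` is nonempty.
  have ht' : ∀ b : Finset (Fin (n + 1)), 0 ∈ b →
      Integrable (truncate F b.card) (Measure.pi fun _ => ν) := by
    intro b hb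
    obtain ⟨m, hm⟩ := Nat.exists_eq_succ_of_ne_zero (Finset.card_ne_zero_of_mem hb)
    rw [hm]
    exact ht m
  simp only [eq_sum_truncate_mul hF]
  rw [integral_finsetSum _ fun b hb => integrable_subtuple_mul ν b
      (ht' b (Finset.mem_filter.mp hb).2) (hi bᶜ.card),
    ← sum_finset_zero_mem_card n fun j l =>
      (∫ y, truncate F j y ∂Measure.pi fun _ => ν) * ∫ y, F l y ∂Measure.pi fun _ => ν]
  exact Finset.sum_congr rfl fun b _ => integral_subtuple_mul ν b _ _

/-- The block equal to the whole index set contributes the truncated function itself. Solving the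
cluster recursion for it leaves only truncations of smaller size on the right. -/
theorem lintegral_truncate_le (hF : ∀ x, F 0 x = 1) (hm : ∀ n, Measurable (F n)) (n : ℕ) :
    ∫⁻ z, ‖truncate F (n + 1) z‖ₑ ∂Measure.pi (fun _ => ν) ≤
      ∫⁻ z, ‖F (n + 1) z‖ₑ ∂Measure.pi (fun _ => ν) +
      ∑ j ∈ Finset.range n, (n.choose j : ℝ≥0∞) *
        ((∫⁻ y, ‖truncate F (j + 1) y‖ₑ ∂Measure.pi fun _ => ν) *
          ∫⁻ y, ‖F (n - j) y‖ₑ ∂Measure.pi fun _ => ν) := by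
  have hmt := measurable_truncate hm
  set S : Finset (Finset (Fin (n + 1))) := Finset.univ.filter fun b => 0 ∈ b with hS
  have huniv : Finset.univ ∈ S := by simp [hS]
  have hpt : ∀ z, ‖truncate F (n + 1) z‖ₑ ≤ ‖F (n + 1) z‖ₑ + ∑ b ∈ S.erase Finset.univ,
      ‖truncate F b.card (subtuple z b)‖ₑ * ‖F bᶜ.card (subtuple z bᶜ)‖ₑ := by
    intro z
    have h1 : truncate F (Finset.univ : Finset (Fin (n + 1))).card (subtuple z Finset.univ) *
        F (Finset.univ : Finset (Fin (n + 1)))ᶜ.card (subtuple z Finset.univᶜ) =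
        truncate F (n + 1) z := by
      rw [family_subtuple_eq (truncate F) z (f := id) (by simp) strictMono_id (by simp),
        family_congr F (n := 0) (y := Fin.elim0) (by simp) (fun i => (Fin.cast (by simp) i).elim0),
        hF, mul_one]
      rfl
    have h2 : truncate F (n + 1) z = F (n + 1) z - ∑ b ∈ S.erase Finset.univ,
        truncate F b.card (subtuple z b) * F bᶜ.card (subtuple z bᶜ) := by
      rw [eq_sum_truncate_mul hF z, ← Finset.add_sum_erase _ _ huniv, h1]
      ring
    rw [h2]
    refine (enorm_sub_le).trans (add_le_add le_rfl ((enorm_sum_le _ _).trans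
      (Finset.sum_le_sum fun b _ => ?_)))
    rw [enorm_mul]
  refine (lintegral_mono hpt).trans (le_of_eq ?_)
  have hms : ∀ b : Finset (Fin (n + 1)), Measurable fun z : Fin (n + 1) → X => subtuple z b :=
    fun b => measurable_pi_lambda _ fun i => measurable_pi_apply _
  have hmul : ∀ b : Finset (Fin (n + 1)), Measurable fun z : Fin (n + 1) → X =>
      ‖truncate F b.card (subtuple z b)‖ₑ * ‖F bᶜ.card (subtuple z bᶜ)‖ₑ := fun b =>
    ((hmt _).comp (hms b)).enorm.mul ((hm _).comp (hms _)).enorm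
  rw [lintegral_add_left (hm _).enorm, lintegral_finsetSum _ fun b _ => hmul b]
  congr 1
  have h3 : ∀ b : Finset (Fin (n + 1)),
      ∫⁻ z, ‖truncate F b.card (subtuple z b)‖ₑ * ‖F bᶜ.card (subtuple z bᶜ)‖ₑ
        ∂Measure.pi (fun _ => ν) =
      (∫⁻ y, ‖truncate F b.card y‖ₑ ∂Measure.pi fun _ => ν) *
        ∫⁻ y, ‖F bᶜ.card y‖ₑ ∂Measure.pi fun _ => ν := fun b =>
    lintegral_subtuple_mul ν b (hmt _).enorm (hm _).enorm
  simp only [h3]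
  -- Setting the summand to zero at `l = 0` removes the full block on one side and the term `j = n`
  -- on the other.
  have h4 := sum_finset_zero_mem_card n fun j l => if l = 0 then 0 else
    (∫⁻ y, ‖truncate F j y‖ₑ ∂Measure.pi fun _ => ν) * ∫⁻ y, ‖F l y‖ₑ ∂Measure.pi fun _ => ν
  rw [← hS, ← Finset.add_sum_erase _ _ huniv, if_pos (by simp), zero_add,
    Finset.sum_range_succ, Nat.sub_self, if_pos rfl, mul_zero, add_zero] at h4
  rw [Finset.sum_congr rfl fun b hb => ?_, h4]
  · refine Finset.sum_congr rfl fun j hj => ?_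
    rw [if_neg (by have := Finset.mem_range.mp hj; omega)]
  · rw [if_neg]
    intro h
    refine (Finset.mem_erase.mp hb).1 ?_
    rwa [Finset.card_eq_zero, Finset.compl_eq_empty_iff] at h

/-- The inductive bound is the exact solution of the majorant recursion. With `a(t) = 1 + D q t / (1
- q t)` the majorant is `-log (2 - a(t)) = log (1 - q t) - log (1 - (1 + D) q t)`, whose
coefficients are `((1 + D)^n - 1) q^n / n`. -/
theorem lintegral_truncate_le_of_bound (hF : ∀ x, F 0 x = 1) (hm : ∀ n, Measurable (F n))
    {D q : ℝ} (hD : 0 < D) (hq : 0 < q)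
    (hb : ∀ n, 1 ≤ n → ∫⁻ z, ‖F n z‖ₑ ∂Measure.pi (fun _ => ν) ≤
      ENNReal.ofReal (n.factorial * D * q ^ n)) (n : ℕ) :
    ∫⁻ z, ‖truncate F (n + 1) z‖ₑ ∂Measure.pi (fun _ => ν) ≤
      ENNReal.ofReal (n.factorial * ((1 + D) ^ (n + 1) - 1) * q ^ (n + 1)) := by
  induction n using Nat.strong_induction_on with
  | _ n ih =>
    have hpow : ∀ j : ℕ, 0 ≤ (1 + D) ^ j - 1 := fun j =>
      sub_nonneg.mpr (one_le_pow₀ (by linarith))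
    refine (lintegral_truncate_le ν hF hm n).trans ?_
    have hterm : ∀ j ∈ Finset.range n, (n.choose j : ℝ≥0∞) *
        ((∫⁻ y, ‖truncate F (j + 1) y‖ₑ ∂Measure.pi fun _ => ν) *
          ∫⁻ y, ‖F (n - j) y‖ₑ ∂Measure.pi fun _ => ν) ≤
        ENNReal.ofReal (n.factorial * (((1 + D) ^ (j + 1) - 1) * D) * q ^ (n + 1)) := by
      intro j hj
      have hj := Finset.mem_range.mp hj
      have hpj := hpow (j + 1)
      refine (mul_le_mul_right (mul_le_mul' (ih j hj) (hb (n - j) (by omega))) _).trans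
        (le_of_eq ?_)
      rw [← ENNReal.ofReal_natCast, ← ENNReal.ofReal_mul (by positivity),
        ← ENNReal.ofReal_mul (by positivity)]
      congr 1
      have h1 : (n.choose j : ℝ) * j.factorial * (n - j).factorial = n.factorial := by
        exact_mod_cast Nat.choose_mul_factorial_mul_factorial hj.le
      have h2 : q ^ (n + 1) = q ^ (j + 1) * q ^ (n - j) := by
        rw [← pow_add]; congr 1; omega
      rw [← h1, h2]
      ring
    refine (add_le_add (hb (n + 1) (by omega)) (Finset.sum_le_sum hterm)).trans ?_
    rw [← ENNReal.ofReal_sum_of_nonneg, ← ENNReal.ofReal_add]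
    · refine ENNReal.ofReal_le_ofReal (le_of_eq ?_)
      rw [← Finset.sum_mul, ← Finset.mul_sum]
      have hgeom : ∀ m : ℕ, ∑ j ∈ Finset.range m, ((1 + D) ^ (j + 1) - 1) * D =
          (1 + D) ^ (m + 1) - (1 + D) - m * D := by
        intro m
        induction m with
        | zero => simp
        | succ m ihm => rw [Finset.sum_range_succ, ihm]; push_cast; ring
      rw [hgeom, Nat.factorial_succ]
      push_cast
      ring
    · positivity
    · exact Finset.sum_nonneg fun j _ => by have := hpow (j + 1); positivity
    · intro j _
      have := hpow (j + 1)
      positivity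

end IntegralRecursion

/-! ### Exponentiating a power series -/

section PowerSeries

theorem hasDerivAt_tsum_mul_pow_succ {S : ℕ → ℝ} {C r s : ℝ} (hr : 0 ≤ r) (hrs : r * s < 1)
    (hs : 0 < s) (hS : ∀ n, |S n| ≤ C * r ^ n) {t : ℝ} (ht : |t| < s) :
    (Summable fun n : ℕ => ‖S n * t ^ (n + 1)‖) ∧ (Summable fun n : ℕ => ‖(n + 1) * S n * t ^ n‖) ∧
    HasDerivAt (fun t => ∑' n : ℕ, S n * t ^ (n + 1)) (∑' n : ℕ, (n + 1) * S n * t ^ n) t := by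
  have hC : 0 ≤ C := by simpa using (abs_nonneg _).trans (hS 0)
  have hu : Summable fun n : ℕ => C * (((n : ℝ) + 1) * (r * s) ^ n) := by
    refine Summable.mul_left _ ?_
    have hnorm : ‖r * s‖ < 1 := by rwa [Real.norm_of_nonneg (by positivity)]
    have h1 := summable_pow_mul_geometric_of_norm_lt_one 1 hnorm
    have h0 := summable_geometric_of_norm_lt_one hnorm
    refine (h1.add h0).congr fun n => ?_
    ring
  have hbound : ∀ (n : ℕ) (y : ℝ), y ∈ Metric.ball (0 : ℝ) s →
      ‖((n : ℝ) + 1) * S n * y ^ n‖ ≤ C * (((n : ℝ) + 1) * (r * s) ^ n) := by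
    intro n y hy
    rw [mem_ball_zero_iff, Real.norm_eq_abs] at hy
    rw [norm_mul, norm_mul, norm_pow, Real.norm_eq_abs, Real.norm_eq_abs, Real.norm_eq_abs,
      abs_of_nonneg (by positivity : (0 : ℝ) ≤ (n : ℝ) + 1), mul_pow]
    calc ((n : ℝ) + 1) * |S n| * |y| ^ n ≤ ((n : ℝ) + 1) * (C * r ^ n) * s ^ n := by
          gcongr
          exact hS n
      _ = _ := by ring
  have hmem : t ∈ Metric.ball (0 : ℝ) s := by rwa [mem_ball_zero_iff, Real.norm_eq_abs]
  have hsum2 : Summable fun n : ℕ => ‖((n : ℝ) + 1) * S n * t ^ n‖ :=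
    Summable.of_nonneg_of_le (fun _ => norm_nonneg _) (fun n => hbound n t hmem) hu
  refine ⟨?_, hsum2, ?_⟩
  · refine Summable.of_nonneg_of_le (fun _ => norm_nonneg _) (fun n => ?_) (hsum2.mul_right |t|)
    rw [pow_succ, ← mul_assoc, norm_mul, Real.norm_eq_abs t]
    gcongr
    rw [mul_assoc, norm_mul (_ + _)]
    refine le_mul_of_one_le_left (norm_nonneg _) ?_
    rw [Real.norm_of_nonneg (by positivity)]
    linarith [(Nat.cast_nonneg n : (0 : ℝ) ≤ n)]
  · refine hasDerivAt_tsum_of_isPreconnected (g := fun (n : ℕ) t => S n * t ^ (n + 1))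
      (y₀ := 0) hu Metric.isOpen_ball
      (convex_ball (0 : ℝ) s).isPreconnected (fun n y _ => ?_) hbound
      (Metric.mem_ball_self hs) ?_ hmem
    · refine ((hasDerivAt_pow (n + 1) y).const_mul (S n)).congr_deriv ?_
      push_cast
      ring
    · simp

/-- If `A' = B' A` as formal power series, `A 0 = 1`, and both series have radius of convergence
greater than one, then `∑ A = exp (∑ B)`. -/
theorem tsum_eq_exp_tsum {A B : ℕ → ℝ} {C r : ℝ} (hr : 0 ≤ r) (hr1 : r < 1) (hA0 : A 0 = 1)
    (hrec : ∀ n : ℕ, ((n : ℝ) + 1) * A (n + 1) =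
      ∑ j ∈ Finset.range (n + 1), ((j : ℝ) + 1) * B (j + 1) * A (n - j))
    (hA : ∀ n, |A (n + 1)| ≤ C * r ^ n) (hB : ∀ n, |B (n + 1)| ≤ C * r ^ n) :
    ∑' n, A n = Real.exp (∑' n, B (n + 1)) := by
  -- The radius must exceed `1`, since both series are evaluated at the point `1`.
  obtain ⟨s, hs1, hrs⟩ : ∃ s : ℝ, 1 < s ∧ r * s < 1 := by
    refine ⟨2 / (1 + r), ?_, ?_⟩
    · rw [lt_div_iff₀ (by linarith)]; linarith
    · rw [mul_div_assoc', div_lt_one (by linarith)]; linarith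
  have hs : 0 < s := by linarith
  set a : ℝ → ℝ := fun t => 1 + ∑' n : ℕ, A (n + 1) * t ^ (n + 1) with ha
  set b : ℝ → ℝ := fun t => ∑' n : ℕ, B (n + 1) * t ^ (n + 1) with hb
  -- The coefficient recursion says `a' = b' a`, so `a e^{-b}` is constant; its value at `0` is `1`.
  have hderiv : ∀ t : ℝ, |t| < s → HasDerivAt (fun t => a t * Real.exp (-b t)) 0 t := by
    intro t ht
    obtain ⟨hsA, hsA', hdA⟩ := hasDerivAt_tsum_mul_pow_succ (S := fun n => A (n + 1)) hr hrs hs hA ht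
    obtain ⟨hsB, hsB', hdB⟩ := hasDerivAt_tsum_mul_pow_succ (S := fun n => B (n + 1)) hr hrs hs hB ht
    have hsum : Summable fun n : ℕ => ‖A n * t ^ n‖ := (summable_nat_add_iff 1).mp hsA
    have ha' : a t = ∑' n : ℕ, A n * t ^ n := by
      rw [ha, hsum.of_norm.tsum_eq_zero_add]; simp [hA0]
    have hode : ∑' n : ℕ, ((n : ℝ) + 1) * A (n + 1) * t ^ n =
        (∑' n : ℕ, ((n : ℝ) + 1) * B (n + 1) * t ^ n) * a t := by
      rw [ha', tsum_mul_tsum_eq_tsum_sum_range_of_summable_norm hsB' hsum]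
      refine tsum_congr fun n => ?_
      rw [hrec, Finset.sum_mul]
      refine Finset.sum_congr rfl fun j hj => ?_
      have : t ^ n = t ^ j * t ^ (n - j) := by
        rw [← pow_add]; congr 1; have := Finset.mem_range.mp hj; omega
      rw [this]; ring
    have h1 : HasDerivAt a (∑' n : ℕ, ((n : ℝ) + 1) * A (n + 1) * t ^ n) t := hdA.const_add 1
    have h2 : HasDerivAt b (∑' n : ℕ, ((n : ℝ) + 1) * B (n + 1) * t ^ n) t := hdB
    refine (h1.mul h2.neg.exp).congr_deriv ?_
    rw [hode]
    ring
  have hconst := constant_of_has_deriv_right_zero (f := fun t => a t * Real.exp (-b t))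
    (a := 0) (b := 1)
    (fun t ht => (hderiv t (by rw [abs_of_nonneg ht.1]; linarith [ht.2])).continuousAt.continuousWithinAt)
    (fun t ht => (hderiv t (by rw [abs_of_nonneg ht.1]; linarith [ht.2])).hasDerivWithinAt)
    1 (by simp)
  obtain ⟨hsA, -, -⟩ := hasDerivAt_tsum_mul_pow_succ (S := fun n => A (n + 1)) hr hrs hs hA
    (t := 1) (by simpa using hs1)
  have hsum : Summable A := by
    have h := (summable_nat_add_iff (f := A) 1).mp (by simpa using hsA.of_norm)
    exact h
  have ha1 : a 1 = ∑' n, A n := by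
    rw [ha, hsum.tsum_eq_zero_add]; simp [hA0]
  simp only [ha1] at hconst
  simp only [ha, hb, one_pow, mul_one, zero_pow (Nat.succ_ne_zero _), mul_zero, tsum_zero,
    add_zero, neg_zero, Real.exp_zero] at hconst
  rw [Real.exp_neg, ← div_eq_mul_inv, div_eq_one_iff_eq (Real.exp_ne_zero _)] at hconst
  exact hconst

end PowerSeries

end

/-! ### Estimates and the finite-volume identity -/

section

/-- The normalisation `(-1)^n / n!` turns the binomial convolutions of the cluster recursions into
Cauchy products. -/
theorem neg_one_pow_div_factorial_mul_sum (x y : ℕ → ℝ) (n : ℕ) :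
    (-1 : ℝ) ^ n / n.factorial * ∑ j ∈ Finset.range (n + 1), (n.choose j : ℝ) * (x j * y (n - j)) =
      ∑ j ∈ Finset.range (n + 1), ((-1 : ℝ) ^ j / j.factorial * x j) *
        ((-1 : ℝ) ^ (n - j) / (n - j).factorial * y (n - j)) := by
  rw [Finset.mul_sum]
  refine Finset.sum_congr rfl fun j hj => ?_
  have hj : j ≤ n := by have := Finset.mem_range.mp hj; omega
  have h1 : (n.choose j : ℝ) * j.factorial * (n - j).factorial = n.factorial := by
    exact_mod_cast Nat.choose_mul_factorial_mul_factorial hj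
  have h2 : (-1 : ℝ) ^ n = (-1) ^ j * (-1) ^ (n - j) := by
    rw [← pow_add]; congr 1; omega
  have h3 : (j.factorial : ℝ) ≠ 0 := by positivity
  have h4 : ((n - j).factorial : ℝ) ≠ 0 := by positivity
  have h5 : (n.choose j : ℝ) ≠ 0 := by exact_mod_cast (Nat.choose_pos hj).ne'
  rw [h2, ← h1]
  field_simp

theorem abs_integral_le_of_lintegral {α : Type*} [MeasurableSpace α] {m : Measure α} {f : α → ℝ}
    {c : ℝ} (hc : 0 ≤ c) (h : ∫⁻ x, ‖f x‖ₑ ∂m ≤ ENNReal.ofReal c) : |∫ x, f x ∂m| ≤ c := by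
  have h1 := (enorm_integral_le_lintegral_enorm f).trans h
  rwa [Real.enorm_eq_ofReal_abs, ENNReal.ofReal_le_ofReal_iff hc] at h1

/-- A difference of extended logarithms has finite absolute value only if both arguments are
positive and finite. Assumption (A) therefore already contains the eventual nondegeneracy of both
integrals. -/
theorem log_ratio_of_tendsto_abs_sub {I p : ℕ → ℝ≥0∞} (hp : ∀ m, p m ≠ ∞)
    (h : Tendsto (fun m => (ENNReal.log (I m) - ENNReal.log (p m)).abs) atTop (𝓝 0)) :
    (∀ᶠ m in atTop, I m ≠ 0 ∧ I m ≠ ∞ ∧ p m ≠ 0) ∧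
      Tendsto (fun m => Real.log (I m).toReal - Real.log (p m).toReal) atTop (𝓝 0) := by
  have hev : ∀ᶠ m in atTop, I m ≠ 0 ∧ I m ≠ ∞ ∧ p m ≠ 0 := by
    filter_upwards [h.eventually_lt_const ENNReal.zero_lt_top] with m hm
    -- If `p m = 0`, the difference is infinite even when `I m = 0`, because `⊥ - ⊥ = ⊥` in `EReal`.
    have hp0 : p m ≠ 0 := by
      intro h0
      rw [h0, ENNReal.log_zero, sub_eq_add_neg, EReal.neg_bot] at hm
      rcases eq_or_ne (ENNReal.log (I m)) ⊥ with h | h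
      · rw [h] at hm; simp at hm
      · rw [EReal.add_top_of_ne_bot h] at hm; simp at hm
    rw [ENNReal.log_pos_real hp0 (hp m)] at hm
    refine ⟨?_, ?_, hp0⟩
    · intro h0
      rw [h0, ENNReal.log_zero] at hm
      simp at hm
    · intro h0
      rw [h0, ENNReal.log_top] at hm
      simp at hm
  refine ⟨hev, ?_⟩
  rw [tendsto_zero_iff_abs_tendsto_zero]
  have h2 := (ENNReal.tendsto_toReal ENNReal.zero_ne_top).comp h
  rw [ENNReal.toReal_zero] at h2
  refine h2.congr' ?_
  filter_upwards [hev] with m hm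
  simp only [Function.comp_apply]
  rw [ENNReal.log_pos_real hm.1 hm.2.1, ENNReal.log_pos_real hm.2.2 (hp m), ← EReal.coe_sub,
    EReal.abs_def, ENNReal.toReal_ofReal (abs_nonneg _)]

/-- Since `ζ ≥ 1`, the hypothesis gives `q < 1 / (2 (2 + D))`, which leaves ample room. -/
theorem one_add_mul_lt_one {D q : ℝ} (hD : 0 < D) (hq : 0 < q)
    (hq0 : q < 1 / (2 * (2 + zeta * D))) : (1 + D) * q < 1 := by
  have h1 := Real.log_two_gt_d9
  have h2 := Real.log_two_lt_d9
  have hz : 1 ≤ zeta := by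
    rw [zeta, le_div_iff₀ (by linarith)]
    linarith
  have hzD : D ≤ zeta * D := le_mul_of_one_le_left hD.le hz
  rw [lt_div_iff₀ (by positivity)] at hq0
  nlinarith

variable {d : ℕ} {Λ : ℕ → Set (Pt d)} {μ : ℝ} {H : Config d → EReal} {P : Measure (Config d)}

theorem IsExhausting.iUnion_box (hΛ : IsExhausting Λ) (k : ℕ) : ⋃ m, box (Λ m) k = Set.univ := by
  refine Set.eq_univ_of_forall fun y => Set.mem_iUnion.mpr ?_
  obtain ⟨m, hm⟩ := hΛ.exhausts (Set.range y) (Set.finite_range y).isBounded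
  exact ⟨m, fun i => hm ⟨i, rfl⟩⟩

theorem IsExhausting.monotone_box (hΛ : IsExhausting Λ) (k : ℕ) :
    Monotone fun m => box (Λ m) k := fun _ _ h => box_mono (hΛ.mono h) k

/-- The Janossy density is the term `k = 0` of the nonnegative series for the correlation function.
-/
theorem janossy_le_corr [SFinite P] (hΛ : IsExhausting Λ) (hH : IsHamiltonian H)
    (hG : IsGibbs Λ μ H P) {Δ : Set (Pt d)} (hb : Bornology.IsBounded Δ) (hm : MeasurableSet Δ)
    {n : ℕ} {x : Fin n → Pt d} (hx : x ∈ box Δ n) :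
    janossy Λ μ H P Δ n x ≤ corr Λ μ H P n x := by
  rw [corr_eq hΛ hH hG hb hm hx, janossy_eq]
  gcongr
  refine le_trans (le_of_eq ?_) (ENNReal.le_tsum 0)
  rw [lintegral_box_zero Δ _ Fin.elim0, Config.union_ofTuple_zero]
  simp [weight]

theorem exists_corr_le [IsProbabilityMeasure P] (hΛ : IsExhausting Λ) (hH : IsHamiltonian H)
    (hG : IsGibbs Λ μ H P) (hR : RuelleCondition Λ μ H P) (n : ℕ) :
    ∃ C : ℝ, ∀ x, corr Λ μ H P n x ≤ ENNReal.ofReal C := by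
  obtain ⟨ξ, -, h⟩ := hR
  rcases Nat.eq_zero_or_pos n with rfl | hn
  · exact ⟨1, fun x => by simp [corr_zero hΛ hH hG]⟩
  · exact ⟨_, h n hn⟩

theorem measurable_truncCorr [SFinite P] (hΛ : IsExhausting Λ) (hH : IsHamiltonian H)
    (hG : IsGibbs Λ μ H P) (n : ℕ) : Measurable (truncCorr Λ μ H P n) :=
  measurable_truncate (fun n => (measurable_corr hΛ hH hG n).ennreal_toReal) n

theorem truncCorr_one (x : Fin 1 → Pt d) :
    truncCorr Λ μ H P 1 x = (corr Λ μ H P 1 x).toReal := by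
  rw [truncCorr, truncate_eq, Finset.sum_eq_zero, sub_zero]
  intro π hπ
  have h1 := (Finset.mem_filter.mp hπ).2
  have h2 := π.card_parts_le_card
  rw [Finset.card_univ, Fintype.card_fin] at h2
  omega

variable (Λ μ H P) in
/-- The functions `ρ_T^{(1+k)}(x, ·) / ρ`. -/
def ratioCorr (x : Pt d) (k : ℕ) (y : Fin k → Pt d) : ℝ :=
  truncCorr Λ μ H P (k + 1) (Fin.cons x y) / density Λ μ H P

theorem measurable_ratioCorr [SFinite P] (hΛ : IsExhausting Λ) (hH : IsHamiltonian H)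
    (hG : IsGibbs Λ μ H P) (x : Pt d) (k : ℕ) : Measurable (ratioCorr Λ μ H P x k) := by
  refine ((measurable_truncCorr hΛ hH hG (k + 1)).comp ?_).div_const _
  refine measurable_pi_lambda _ fun i => ?_
  refine Fin.cases ?_ (fun i => ?_) i
  · simp
  · simpa using measurable_pi_apply i

theorem ratioCorr_zero (hρ : 0 < density Λ μ H P) (y : Fin 0 → Pt d) :
    ratioCorr Λ μ H P 0 0 y = 1 := by
  rw [ratioCorr, truncCorr_one, div_eq_one_iff_eq hρ.ne', density]
  congr 2
  funext i
  exact Fin.cases rfl (fun j => j.elim0) i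

/-- The constants in (B) do not depend on the volume, so monotone convergence carries the bound to
the whole space. -/
theorem lintegral_ratioCorr_le {D q : ℝ} (hΛ : IsExhausting Λ) (hρ : 0 < density Λ μ H P)
    (hB : AssumptionB Λ μ H P D q) (x : Pt d) {k : ℕ} (hk : 1 ≤ k) :
    ∫⁻ y, ‖ratioCorr Λ μ H P x k y‖ₑ ≤ ENNReal.ofReal (k.factorial * D * q ^ k) := by
  rw [← setLIntegral_univ, ← hΛ.iUnion_box k,
    setLIntegral_iUnion_of_directed _ (hΛ.monotone_box k).directed_le]
  refine iSup_le fun m => ?_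
  refine le_of_eq_of_le (lintegral_congr fun y => ?_)
    (hB (Λ m) (hΛ.bounded m) (hΛ.measurable m) k hk x)
  rw [Real.enorm_eq_ofReal_abs, ratioCorr, abs_div, abs_of_pos hρ, div_eq_inv_mul, one_div]

theorem lintegral_tildeCorr_le [SFinite P] {D q : ℝ} (hΛ : IsExhausting Λ) (hH : IsHamiltonian H)
    (hG : IsGibbs Λ μ H P) (hρ : 0 < density Λ μ H P) (hD : 0 < D) (hq : 0 < q)
    (hB : AssumptionB Λ μ H P D q) (k : ℕ) :
    ∫⁻ y, ‖tildeCorr Λ μ H P 0 (k + 1) y‖ₑ ≤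
      ENNReal.ofReal ((k + 1).factorial * ((1 + D) * q) ^ (k + 1)) := by
  have h := lintegral_truncate_le_of_bound (volume : Measure (Pt d)) (ratioCorr_zero hρ)
    (measurable_ratioCorr hΛ hH hG 0) hD hq
    (fun n hn => lintegral_ratioCorr_le hΛ hρ hB 0 hn) k
  refine h.trans (ENNReal.ofReal_le_ofReal ?_)
  rw [mul_pow, ← mul_assoc]
  gcongr
  · exact sub_nonneg.mpr (one_le_pow₀ (by linarith))
  · omega
  · linarith

theorem measurable_tildeCorr [SFinite P] (hΛ : IsExhausting Λ) (hH : IsHamiltonian H)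
    (hG : IsGibbs Λ μ H P) (k : ℕ) : Measurable (tildeCorr Λ μ H P 0 k) :=
  measurable_truncate (measurable_ratioCorr hΛ hH hG 0) k

theorem integrable_tildeCorr [SFinite P] {D q : ℝ} (hΛ : IsExhausting Λ) (hH : IsHamiltonian H)
    (hG : IsGibbs Λ μ H P) (hρ : 0 < density Λ μ H P) (hD : 0 < D) (hq : 0 < q)
    (hB : AssumptionB Λ μ H P D q) (k : ℕ) : Integrable (tildeCorr Λ μ H P 0 (k + 1)) :=
  ⟨(measurable_tildeCorr hΛ hH hG _).aestronglyMeasurable,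
    (lintegral_tildeCorr_le hΛ hH hG hρ hD hq hB k).trans_lt ENNReal.ofReal_lt_top⟩

theorem abs_term_le {r : ℝ} {k : ℕ} {I : ℝ} (h : |I| ≤ (k.factorial : ℝ) * r) :
    |(-1 : ℝ) ^ k / k.factorial * I| ≤ r := by
  have hf : (0 : ℝ) < k.factorial := by positivity
  rw [abs_mul, abs_div, abs_pow, abs_neg, abs_one, one_pow, abs_of_pos hf, div_mul_eq_mul_div,
    one_mul, div_le_iff₀ hf, mul_comm]
  exact h

theorem abs_tildeCorr_term_le [SFinite P] {D q : ℝ} (hΛ : IsExhausting Λ) (hH : IsHamiltonian H)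
    (hG : IsGibbs Λ μ H P) (hρ : 0 < density Λ μ H P) (hD : 0 < D) (hq : 0 < q)
    (hB : AssumptionB Λ μ H P D q) {k : ℕ} (S : Set (Fin (k + 1) → Pt d)) :
    |(-1 : ℝ) ^ (k + 1) / (k + 1).factorial * ∫ y in S, tildeCorr Λ μ H P 0 (k + 1) y| ≤
      ((1 + D) * q) ^ (k + 1) :=
  abs_term_le (abs_integral_le_of_lintegral (by positivity)
    ((setLIntegral_le_lintegral _ _).trans (lintegral_tildeCorr_le hΛ hH hG hρ hD hq hB k)))

/-- The finite-volume identity between the one-point and the zero-point Janossy densities. -/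
theorem janossy_one_eq [IsProbabilityMeasure P] {D q : ℝ} (hΛ : IsExhausting Λ)
    (hH : IsHamiltonian H) (hG : IsGibbs Λ μ H P) (hR : RuelleCondition Λ μ H P)
    (hρ : 0 < density Λ μ H P) (hD : 0 < D) (hq : 0 < q) (hr : (1 + D) * q < 1)
    (hB : AssumptionB Λ μ H P D q) {Δ : Set (Pt d)} (hb : Bornology.IsBounded Δ)
    (hm : MeasurableSet Δ) (h0 : (0 : Pt d) ∈ Δ) :
    (janossy Λ μ H P Δ 1 fun _ => 0).toReal = density Λ μ H P *
      Real.exp (∑' k : ℕ, (-1 : ℝ) ^ (k + 1) / (k + 1).factorial *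
        ∫ y in box Δ (k + 1), tildeCorr Λ μ H P 0 (k + 1) y) *
      (P (Config.outside Δ)).toReal := by
  set ν : Measure (Pt d) := volume.restrict Δ with hν
  have : IsFiniteMeasure ν := ⟨by rw [hν, Measure.restrict_apply_univ]; exact hb.measure_lt_top⟩
  set ρ := density Λ μ H P with hρdef
  set r := (1 + D) * q with hrdef
  have hr0 : 0 ≤ r := by positivity
  set F : ∀ n : ℕ, (Fin n → Pt d) → ℝ := fun n x => (corr Λ μ H P n x).toReal with hF
  have hF0 : ∀ x, F 0 x = 1 := fun x => by simp [hF, corr_zero hΛ hH hG]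
  set G := ratioCorr Λ μ H P 0 with hGdef
  have hG0 : ∀ y, G 0 y = 1 := ratioCorr_zero hρ
  have hFi : ∀ n, Integrable (F n) (Measure.pi fun _ => ν) := by
    intro n
    obtain ⟨C, hC⟩ := exists_corr_le hΛ hH hG hR n
    refine Integrable.of_bound
      (measurable_corr hΛ hH hG n).ennreal_toReal.aestronglyMeasurable (max C 0)
      (Eventually.of_forall fun x => ?_)
    rw [Real.norm_of_nonneg ENNReal.toReal_nonneg]
    refine ENNReal.toReal_le_of_le_ofReal (le_max_right _ _) ((hC x).trans ?_)
    exact ENNReal.ofReal_le_ofReal (le_max_left _ _)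
  have hGi : ∀ n, Integrable (G n) (Measure.pi fun _ => ν) := by
    intro n
    rcases Nat.eq_zero_or_pos n with rfl | hn
    · rw [funext hG0]; exact integrable_const _
    · rw [hν, ← volume_restrict_box]
      exact Integrable.restrict ⟨(measurable_ratioCorr hΛ hH hG 0 n).aestronglyMeasurable,
        (lintegral_ratioCorr_le hΛ hρ hB 0 hn).trans_lt ENNReal.ofReal_lt_top⟩
  have hTG : ∀ n (y : Fin n → Pt d), truncate F (n + 1) (Fin.cons 0 y) = ρ * G n y := by
    intro n y
    rw [hGdef, ratioCorr, mul_div_cancel₀ _ hρ.ne']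
    rfl
  have hUi : ∀ n, Integrable (truncate G (n + 1)) (Measure.pi fun _ => ν) := by
    intro n
    rw [hν, ← volume_restrict_box]
    exact (integrable_tildeCorr hΛ hH hG hρ hD hq hB n).restrict
  set A : ℕ → ℝ := fun k => (-1 : ℝ) ^ k / k.factorial * ∫ y, G k y ∂Measure.pi fun _ => ν with hA
  set B : ℕ → ℝ := fun k =>
    (-1 : ℝ) ^ k / k.factorial * ∫ y, truncate G k y ∂Measure.pi fun _ => ν with hBdef
  set p : ℕ → ℝ := fun k => (-1 : ℝ) ^ k / k.factorial * ∫ y, F k y ∂Measure.pi fun _ => ν with hp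
  have hAbound : ∀ n, |A (n + 1)| ≤ r * r ^ n := by
    intro n
    rw [← pow_succ']
    refine abs_term_le (abs_integral_le_of_lintegral (by positivity) ?_)
    rw [hν, ← volume_restrict_box]
    refine (setLIntegral_le_lintegral _ _).trans
      ((lintegral_ratioCorr_le hΛ hρ hB 0 (Nat.succ_le_succ n.zero_le)).trans
        (ENNReal.ofReal_le_ofReal ?_))
    rw [hrdef, mul_pow, ← mul_assoc]
    gcongr
    calc D ≤ 1 + D := by linarith
      _ ≤ (1 + D) ^ (n + 1) := le_self_pow₀ (by linarith) (Nat.succ_ne_zero n)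
  have hBbound : ∀ n, |B (n + 1)| ≤ r * r ^ n := by
    intro n
    rw [← pow_succ', hBdef]
    simp only
    rw [hν, ← volume_restrict_box]
    exact abs_tildeCorr_term_le hΛ hH hG hρ hD hq hB _
  have hA0 : A 0 = 1 := by
    simp only [hA, hG0]
    rw [Measure.pi_of_empty (x := Fin.elim0)]
    simp
  -- This is the integrated cluster recursion for `G`. Lowering the index by one costs a sign on
  -- each side, and the signs cancel.
  have hArec : ∀ n : ℕ, ((n : ℝ) + 1) * A (n + 1) =
      ∑ j ∈ Finset.range (n + 1), ((j : ℝ) + 1) * B (j + 1) * A (n - j) := by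
    intro n
    have hshift : ∀ (j : ℕ) (x : ℝ), ((j : ℝ) + 1) * ((-1 : ℝ) ^ (j + 1) / (j + 1).factorial * x) =
        -((-1 : ℝ) ^ j / j.factorial * x) := by
      intro j x
      rw [Nat.factorial_succ, pow_succ]
      have : (j.factorial : ℝ) ≠ 0 := by positivity
      have : (j : ℝ) + 1 ≠ 0 := by positivity
      push_cast
      field_simp
    simp only [hA, hBdef, hshift]
    rw [integral_eq_sum ν hG0 hGi hUi n, neg_one_pow_div_factorial_mul_sum
      (fun j => ∫ y, truncate G (j + 1) y ∂Measure.pi fun _ => ν)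
      (fun j => ∫ y, G j y ∂Measure.pi fun _ => ν), ← Finset.sum_neg_distrib]
    exact Finset.sum_congr rfl fun j _ => by ring
  have hexp := tsum_eq_exp_tsum hr0 hr hA0 hArec hAbound hBbound
  have hAsum : Summable fun k => ‖ρ * A k‖ := by
    simp only [norm_mul]
    refine Summable.mul_left _ ((summable_nat_add_iff 1).mp ?_)
    exact Summable.of_nonneg_of_le (fun _ => norm_nonneg _) hAbound
      ((summable_geometric_of_lt_one hr0 hr).mul_left r)
  have hpsum : HasSum p (P (Config.outside Δ)).toReal := by
    have h := hasSum_janossy hΛ hH hG hR hb hm (n := 0) (x := Fin.elim0) (fun i => i.elim0)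
    rw [janossy_zero hG hb hm] at h
    convert h using 1
    funext k
    simp only [hp, hF]
    rw [volume_restrict_box, ← hν]
    congr 2
    funext y
    congr 1
    refine corr_congr hΛ hH hG (Nat.zero_add k).symm ?_
    rw [Config.ofTuple_append, Config.ofTuple_zero_union]
  -- The cluster of the origin carries `ρ * A j`; the remaining points carry the coefficients `p` of
  -- the zero-point Janossy density.
  have hjsum : HasSum (fun n => ∑ j ∈ Finset.range (n + 1), ρ * A j * p (n - j))
      (janossy Λ μ H P Δ 1 fun _ => 0).toReal := by
    have h := hasSum_janossy hΛ hH hG hR hb hm (n := 1) (x := fun _ => 0) (fun _ => h0)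
    convert h using 1
    funext n
    have h1 : ∫ y in box Δ n, (corr Λ μ H P (1 + n) (Fin.append (fun _ : Fin 1 => 0) y)).toReal =
        ∫ y, F (n + 1) (Fin.cons 0 y) ∂Measure.pi fun _ => ν := by
      rw [volume_restrict_box, ← hν]
      congr 1
      funext y
      simp only [hF]
      congr 1
      refine corr_congr hΛ hH hG (Nat.add_comm 1 n) ?_
      rw [Config.ofTuple_append, Config.ofTuple_cons, Config.ofTuple_succ (fun _ : Fin 1 => 0),
        Config.union_ofTuple_zero]
    rw [h1, integral_cons_eq_sum ν hF0 0 hFi (fun n => by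
      simp only [hTG]; exact (hGi n).const_mul ρ) n]
    simp only [hTG, integral_const_mul]
    rw [neg_one_pow_div_factorial_mul_sum
      (fun j => ρ * ∫ y, G j y ∂Measure.pi fun _ => ν)
      (fun j => ∫ y, F j y ∂Measure.pi fun _ => ν)]
    exact Finset.sum_congr rfl fun j _ => by simp only [hA, hp]; ring
  have hprod := tsum_mul_tsum_eq_tsum_sum_range_of_summable_norm hAsum hpsum.summable.norm
  rw [hjsum.tsum_eq, hpsum.tsum_eq, tsum_mul_left, hexp] at hprod
  rw [← hprod]
  simp only [hBdef, hν, ← volume_restrict_box]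
  rfl

end

end Gibbs

end

/-! ### The infinite-volume limit -/

theorem theorem3p1 {d : ℕ} (hd : 1 ≤ d)
    (Λ : ℕ → Set (Gibbs.Pt d)) (hΛ : Gibbs.IsExhausting Λ)
    (μ : ℝ) (H : Gibbs.Config d → EReal) (hH : Gibbs.IsHamiltonian H)
    (P : Measure (Gibbs.Config d)) [IsProbabilityMeasure P]
    (hTI : Gibbs.IsTranslationInvariant P)
    (hGibbs : Gibbs.IsGibbs Λ μ H P)
    (hRuelle : Gibbs.RuelleCondition Λ μ H P)
    (hA : Gibbs.AssumptionA Λ H P)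
    (D q : ℝ) (hD : 0 < D) (hq : 0 < q)
    (hB : Gibbs.AssumptionB Λ μ H P D q)
    (hq0 : q < 1 / (2 * (2 + Gibbs.zeta * D))) :
    0 < Gibbs.density Λ μ H P ∧
    (∀ k : ℕ, 1 ≤ k → Integrable (fun y : Fin k → Gibbs.Pt d => Gibbs.tildeCorr Λ μ H P 0 k y)) ∧
    Summable (fun k : ℕ => (-1 : ℝ) ^ (k + 1) / ((k + 1).factorial : ℝ) *
      ∫ y : Fin (k + 1) → Gibbs.Pt d, Gibbs.tildeCorr Λ μ H P 0 (k + 1) y) ∧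
    μ = Real.log (Gibbs.density Λ μ H P) +
      ∑' k : ℕ, (-1 : ℝ) ^ (k + 1) / ((k + 1).factorial : ℝ) *
        ∫ y : Fin (k + 1) → Gibbs.Pt d, Gibbs.tildeCorr Λ μ H P 0 (k + 1) y := by
  have hr := Gibbs.one_add_mul_lt_one hD hq hq0
  have hr0 : 0 ≤ (1 + D) * q := by positivity
  set I : ℕ → ℝ≥0∞ := fun m => ∫⁻ η in Gibbs.Config.outside (Λ m),
    EReal.exp (-Gibbs.interaction Λ H (Gibbs.Config.single 0) η) ∂P with hI
  set p : ℕ → ℝ≥0∞ := fun m => P (Gibbs.Config.outside (Λ m)) with hp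
  -- Only the origin matters here, so the supremum in (A) is taken over a single point.
  have hA0 := hA {0} Bornology.isBounded_singleton
  simp only [iSup_singleton] at hA0
  obtain ⟨hev, hlog⟩ := Gibbs.log_ratio_of_tendsto_abs_sub (I := I) (p := p)
    (fun m => measure_ne_top _ _) hA0
  have hmem : ∀ᶠ m in atTop, (0 : Gibbs.Pt d) ∈ Λ m := by
    obtain ⟨m₀, hm₀⟩ := hΛ.exhausts {0} Bornology.isBounded_singleton
    filter_upwards [eventually_ge_atTop m₀] with m hm
    exact hΛ.mono hm (hm₀ rfl)
  have hjan : ∀ m, Gibbs.janossy Λ μ H P (Λ m) 1 (fun _ => 0) =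
      ENNReal.ofReal (Real.exp μ) * I m := fun m => Gibbs.janossy_one hH _
  -- By (A), the one-point Janossy density at the origin is positive in a large volume, and it
  -- bounds the density from below.
  have hρ : 0 < Gibbs.density Λ μ H P := by
    obtain ⟨m, hm, h0⟩ := (hev.and hmem).exists
    obtain ⟨C, hC⟩ := Gibbs.exists_corr_le hΛ hH hGibbs hRuelle 1
    refine ENNReal.toReal_pos ?_ ((hC _).trans_lt ENNReal.ofReal_lt_top).ne
    refine (lt_of_lt_of_le ?_ (Gibbs.janossy_le_corr hΛ hH hGibbs (hΛ.bounded m)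
      (hΛ.measurable m) fun _ => h0)).ne'
    rw [hjan]
    exact ENNReal.mul_pos (by simpa using Real.exp_pos μ) hm.1
  have hbound : ∀ (k : ℕ) (S : Set (Fin (k + 1) → Gibbs.Pt d)),
      ‖(-1 : ℝ) ^ (k + 1) / ((k + 1).factorial : ℝ) *
        ∫ y in S, Gibbs.tildeCorr Λ μ H P 0 (k + 1) y‖ ≤ ((1 + D) * q) ^ (k + 1) :=
    fun k S => Gibbs.abs_tildeCorr_term_le hΛ hH hGibbs hρ hD hq hB S
  have hgeom : Summable fun k : ℕ => ((1 + D) * q) ^ (k + 1) :=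
    (summable_nat_add_iff 1).mpr (summable_geometric_of_lt_one hr0 hr)
  have hint := Gibbs.integrable_tildeCorr hΛ hH hGibbs hρ hD hq hB
  refine ⟨hρ, fun k hk => ?_, Summable.of_norm_bounded hgeom fun k => ?_, ?_⟩
  · obtain ⟨k, rfl⟩ := Nat.exists_eq_succ_of_ne_zero (Nat.one_le_iff_ne_zero.mp hk)
    exact hint k
  · have := hbound k Set.univ
    rwa [Measure.restrict_univ] at this
  · set S : ℕ → ℝ := fun m => ∑' k : ℕ, (-1 : ℝ) ^ (k + 1) / ((k + 1).factorial : ℝ) *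
      ∫ y in Gibbs.box (Λ m) (k + 1), Gibbs.tildeCorr Λ μ H P 0 (k + 1) y with hS
    have hlim : Tendsto S atTop (𝓝 (∑' k : ℕ, (-1 : ℝ) ^ (k + 1) / ((k + 1).factorial : ℝ) *
        ∫ y : Fin (k + 1) → Gibbs.Pt d, Gibbs.tildeCorr Λ μ H P 0 (k + 1) y)) := by
      refine tendsto_tsum_of_dominated_convergence hgeom (fun k => Tendsto.const_mul _ ?_)
        (Eventually.of_forall fun m k => hbound k _)
      have h := tendsto_setIntegral_of_monotone (μ := volume)
        (f := Gibbs.tildeCorr Λ μ H P 0 (k + 1))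
        (fun m => Gibbs.measurableSet_box (hΛ.measurable m) (k + 1)) (hΛ.monotone_box (k + 1))
        (hint k).integrableOn
      rwa [hΛ.iUnion_box, Measure.restrict_univ] at h
    -- The logarithm of the finite-volume identity. As `m` grows, the left side tends to `μ` by (A)
    -- and the right side converges by dominated convergence.
    have heq : ∀ᶠ m in atTop, μ + (Real.log (I m).toReal - Real.log (p m).toReal) =
        Real.log (Gibbs.density Λ μ H P) + S m := by
      filter_upwards [hev, hmem] with m hm h0
      have h := Gibbs.janossy_one_eq hΛ hH hGibbs hRuelle hρ hD hq hr hB (hΛ.bounded m)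
        (hΛ.measurable m) h0
      rw [hjan, ENNReal.toReal_mul, ENNReal.toReal_ofReal (Real.exp_pos μ).le] at h
      have hIpos : (I m).toReal ≠ 0 := (ENNReal.toReal_pos hm.1 hm.2.1).ne'
      have hppos : (p m).toReal ≠ 0 := (ENNReal.toReal_pos hm.2.2 (measure_ne_top _ _)).ne'
      have hl := congrArg Real.log h
      rw [Real.log_mul (Real.exp_pos μ).ne' hIpos, Real.log_exp,
        Real.log_mul (mul_pos hρ (Real.exp_pos _)).ne' hppos,
        Real.log_mul hρ.ne' (Real.exp_pos _).ne', Real.log_exp] at hl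
      simp only [hS, hp] at hl ⊢
      linarith
    have h1 := hlog.const_add μ
    rw [add_zero] at h1
    exact tendsto_nhds_unique h1 ((hlim.const_add _).congr' (heq.mono fun m h => h.symm))
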